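/- Let $\mathcal P$ be the set of all integer partitions; for $\nu\in\mathcal P$ write $|\nu|$ for its size, $l(\nu)$ for its length, $\nu^t$ for its conjugate, $\nu_i=0$ for $i>l(\nu)$, and $\kappa(\nu)=\sum_{i=1}^{l(\nu)}\nu_i(\nu_i-2i+1)$. Let $s_{\lambda}=\det(h_{\lambda_i-i+j})_{i,j=1}^{l(\lambda)}$ and $s_{\lambda/\mu}=\sum_\nu c^\lambda_{\mu\nu}s_\nu$ be the Schur and skew Schur functions, where $s_\mu s_\nu=\sum_\lambda c^\lambda_{\mu\nu}s_\lambda$, and let $f(q^{\nu+\rho})$ denote the value of a symmetric function $f$ at $x_i=q^{\nu_i-i+1/2}$, $i\ge1$ (convergent for $|q|>1$); $f(q^\rho)=f(q^{\emptyset+\rho})$. The topological vertex is $$C_{\lambda,\mu,\nu}(q)=q^{\kappa(\lambda)/2+\kappa(\nu)/2}\,s_{\nu^t}(q^\rho)\sum_{\eta\in\mathcal P}s_{\lambda^t/\eta}(q^{\nu+\rho})\,s_{\mu/\eta}(q^{\nu^t+\rho}).$$ Put $$Z(Q;Q_1,q)=\sum_{\mu,\nu\in\mathcal P}(-Q_1)^{|\mu|}(-Q)^{|\nu|}\,C_{\emptyset,\mu^t,\nu}(q)\,C_{\emptyset,\mu,\nu^t}(q),$$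 $$Z(Q;Q_1,q;s_1,\dots,s_n)=\frac1{Z(Q;Q_1,q)}\sum_{\mu,\nu\in\mathcal P}(-Q_1)^{|\mu|}(-Q)^{|\nu|}\,C_{\emptyset,\mu^t,\nu}(q)\,C_{\emptyset,\mu,\nu^t}(q)\prod_{j=1}^n\sum_{i=1}^\infty s_j^{\nu_i-i+\frac12},$$ $$F(Q;s_1,\dots,s_n)=\frac1{\sum_{\nu\in\mathcal P}Q^{|\nu|}}\sum_{\nu\in\mathcal P}Q^{|\nu|}\prod_{j=1}^n\sum_{i=1}^\infty s_j^{\nu_i-i+\frac12}.$$ Let $n\ge0$ and let $Q,s_1,\dots,s_n\in\mathbb C$ satisfy $|Q|<1$, $|s_j|>1$ for all $j$, and $|Q|\,|s_1\cdots s_n|<1$; fix square roots $s_j^{1/2}$. Then all the series in $F(Q;s_1,\dots,s_n)$ converge absolutely and $\sum_{\nu\in\mathcal P} Q^{|\nu|}\ne0$; for all complex $q$ with $|q|$ sufficiently large (and either choice of $q^{1/2}$) the series over $(\mu,\nu)$ defining $Z(Q;1,q)$ and the numerator of $Z(Q;1,q;s_1,\dots,s_n)$ converge absolutely and $Z(Q;1,q)\neq0$;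 and $$F(Q;s_1,\dots,s_n)=\lim_{q\to\infty}Z(Q;Q_1,q;s_1,\dots,s_n)\big|_{Q_1=1}.$$ -/

import Mathlib

namespace TopVertex

noncomputable section

/-! Integer partitions are Young diagrams. For `nu : YoungDiagram` the part `ν_{i+1}` is
`nu.rowLen i` (zero beyond the length), the length `l(ν)` is `nu.colLen 0`, the size `|ν|` is
`nu.card`, the conjugate `ν^t` is `nu.transpose`, and the empty partition is `⊥`. -/

/-- The ring of symmetric functions over `ℚ` in infinitely many variables, as the polynomial ring
on its algebraic basis: the variable `X r` is the complete symmetric function `h_{r+1}`. -/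
abbrev SymFun : Type := MvPolynomial ℕ ℚ

/-- The complete symmetric functions `h_r`, with `h_0 = 1` and `h_r = 0` for `r < 0`. -/
def complete : ℤ → SymFun
  | Int.ofNat 0 => 1
  | Int.ofNat (r + 1) => MvPolynomial.X r
  | Int.negSucc _ => 0

/-- The Schur function `s_λ = det (h_{λ_i - i + j})_{1 ≤ i, j ≤ l(λ)}`. -/
def schur (lam : YoungDiagram) : SymFun :=
  (Matrix.of fun i j : Fin (lam.colLen 0) =>
    complete ((lam.rowLen i : ℤ) - (i : ℤ) + (j : ℤ))).det

open Classical in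
/-- The coefficients of a symmetric function in the linear basis of Schur functions. (The Schur
functions being a basis, the expansion exists and is unique.) -/
def schurCoeff (f : SymFun) : YoungDiagram →₀ ℚ :=
  if h : ∃ c : YoungDiagram →₀ ℚ, f = c.sum fun lam a => a • schur lam then h.choose else 0

/-- The Littlewood–Richardson coefficient `c^λ_{μν}`, defined by `s_μ s_ν = ∑_λ c^λ_{μν} s_λ`. -/
def lrCoeff (lam mu nu : YoungDiagram) : ℚ :=
  schurCoeff (schur mu * schur nu) lam

/-- The skew Schur function `s_{λ/μ} = ∑_ν c^λ_{μν} s_ν` (a finite sum, as `c^λ_{μν} = 0` unless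
`|λ| = |μ| + |ν|`). -/
def skewSchur (lam mu : YoungDiagram) : SymFun :=
  ∑ᶠ nu : YoungDiagram, lrCoeff lam mu nu • schur nu

/-- The value `h_r(x) = ∑_{i_1 ≤ … ≤ i_r} x_{i_1} ⋯ x_{i_r}` at a sequence `x` of complex numbers
(an absolutely convergent sum when `∑ |x_i| < ∞`). -/
def completeAt (x : ℕ → ℂ) (r : ℕ) : ℂ :=
  ∑' m : Sym ℕ r, ((m : Multiset ℕ).map x).prod

/-- Evaluation `f ↦ f(x_1, x_2, …)` of symmetric functions at a sequence of complex numbers. -/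
def evalAt (x : ℕ → ℂ) : SymFun →ₐ[ℚ] ℂ :=
  MvPolynomial.aeval fun r => completeAt x (r + 1)

/-- The sequence `i ↦ z^{ν_i - i + 1/2}`, `i ≥ 1`, in terms of a square root `w` of `z`. For `z = q`
this is the point `q^{ν + ρ}`; for `ν = ∅` it is `q^ρ = (q^{-1/2}, q^{-3/2}, …)`. -/
def shiftPow (w : ℂ) (nu : YoungDiagram) (i : ℕ) : ℂ :=
  w ^ (2 * ((nu.rowLen i : ℤ) - ((i : ℤ) + 1)) + 1)

/-- `κ(λ) = ∑_i λ_i (λ_i - 2 i + 1)`, `1 ≤ i ≤ l(λ)`. -/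
def kappa (lam : YoungDiagram) : ℤ :=
  ∑ i ∈ Finset.range (lam.colLen 0),
    (lam.rowLen i : ℤ) * ((lam.rowLen i : ℤ) - 2 * ((i : ℤ) + 1) + 1)

/-- The topological vertex
`C_{λ,μ,ν}(q) = q^{κ(λ)/2 + κ(ν)/2} s_{ν^t}(q^ρ) ∑_η s_{λ^t/η}(q^{ν+ρ}) s_{μ/η}(q^{ν^t+ρ})`
as a function of `w = q^{1/2}`, `|q| > 1`. The sum over `η` has finitely many nonzero terms. -/
def vertex (w : ℂ) (lam mu nu : YoungDiagram) : ℂ :=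
  w ^ (kappa lam + kappa nu) * evalAt (shiftPow w ⊥) (schur nu.transpose) *
    ∑ᶠ eta : YoungDiagram,
      evalAt (shiftPow w nu) (skewSchur lam.transpose eta) *
        evalAt (shiftPow w nu.transpose) (skewSchur mu eta)

/-- `∏_j ∑_{i ≥ 1} s_j^{ν_i - i + 1/2}`, in terms of `v_j = s_j^{1/2}`. -/
def pointFactor {n : ℕ} (v : Fin n → ℂ) (nu : YoungDiagram) : ℂ :=
  ∏ j, ∑' i : ℕ, shiftPow (v j) nu i

/-- The summand of the `q`-deformed partition function attached to `(μ, ν)`,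
in terms of `w = q^{1/2}`. -/
def zTerm (Q Q₁ w : ℂ) (p : YoungDiagram × YoungDiagram) : ℂ :=
  (-Q₁) ^ p.1.card * (-Q) ^ p.2.card *
    vertex w ⊥ p.1.transpose p.2 * vertex w ⊥ p.1 p.2.transpose

/-- The `q`-deformed partition function `Z(Q; Q₁, q)`, in terms of `w = q^{1/2}`. -/
def Z (Q Q₁ w : ℂ) : ℂ :=
  ∑' p : YoungDiagram × YoungDiagram, zTerm Q Q₁ w p

/-- The `q`-deformed `n`-point function `Z(Q; Q₁, q; s_1, …, s_n)`, in terms of `w = q^{1/2}` and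
`v_j = s_j^{1/2}`. -/
def Zn {n : ℕ} (Q Q₁ w : ℂ) (v : Fin n → ℂ) : ℂ :=
  1 / Z Q Q₁ w *
    ∑' p : YoungDiagram × YoungDiagram, zTerm Q Q₁ w p * pointFactor v p.2

/-- The Bloch–Okounkov `n`-point function `F(Q; s_1, …, s_n)` of all integer partitions, in terms of
`v_j = s_j^{1/2}`. -/
def blochOkounkov {n : ℕ} (Q : ℂ) (v : Fin n → ℂ) : ℂ :=
  1 / (∑' nu : YoungDiagram, Q ^ nu.card) *
    ∑' nu : YoungDiagram, pointFactor v nu * Q ^ nu.card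

end

end TopVertex

namespace TopVertex

noncomputable section

open Finset Filter Topology

/-! ### Young diagrams -/

/-! At Q₁ = 1 nothing is left of the deformation: once |q| is large, Z(Q; 1, q; s) is equal to F(Q;
s), and the limit is that of an eventually constant function.

With an empty first leg only η = ∅ survives in the vertex, and the powers of q in front cancel
because κ(ν^t) = -κ(ν) (`zTerm_one_eq`). The sum over μ is then a signed dual Cauchy sum at q^{ν+ρ}
and q^{ν^t+ρ}, that is, the product of 1 - q^{h(i,j)} over all i, j ≥ 1, where h(i,j) = ν_i + ν^t_j
- i - j + 1 is the hook length on the cells of ν and negative outside. The key fact is that s_ν(q^ρ)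
s_{ν^t}(q^ρ) times this product is (-1)^{|ν|} times its value at ν = ∅ (`schurPair_mul_innerSum`).
The sign turns (-Q)^{|ν|} into Q^{|ν|}, and the common nonzero constant cancels between the
numerator and Z(Q; 1, q).

The key fact is a particle-hole argument. Counting from 0, the numbers ν_i - i and j + 1 - ν^t_j of
a diagram inside an N × N box together fill an interval of 2N integers that does not depend on ν, so
neither does the product of 1 - q^{-|a-b|} over its pairs. Up to monomials in q^{1/2} and
normalizations independent of ν, pairs of rows give the Vandermonde determinant of s_ν(q^ρ), pairs
of columns that of s_{ν^t}(q^ρ), and mixed pairs the Cauchy product. This is done with N variables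
(`schurFin_mul_schurFin_mul_prod`), and then N → ∞.

For absolute convergence, 1 - q^h must be replaced by 1 + |q|^h. `prod_one_add_norm_le` shows that
this costs at most exp(9|ν|/|q| + 3), while the factors in the s_j cost a constant times |s_1 ⋯
s_n|^{|ν|}. The strict inequalities on Q leave room for e^{9/|q|} when |q| is large. -/

theorem rowLen_injective : Function.Injective YoungDiagram.rowLen := by
  intro mu nu h
  ext ⟨i, j⟩
  simp only [YoungDiagram.mem_cells, YoungDiagram.mem_iff_lt_rowLen, h]

/-- The Young diagram with row lengths `f 0 ≥ f 1 ≥ ⋯`, where `f i = 0` for `i ≥ N`. -/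
def ofAntitone (N : ℕ) (f : ℕ → ℕ) (hf : Antitone f) : YoungDiagram where
  cells := (range N ×ˢ range (f 0)).filter fun c => c.2 < f c.1
  isLowerSet := by
    rintro ⟨a, b⟩ ⟨c, d⟩ h hab
    obtain ⟨h1, h2⟩ := Prod.mk_le_mk.1 h
    simp only [coe_filter, mem_product, mem_range, Set.mem_ofPred_eq] at hab ⊢
    have := hf h1
    omega

theorem rowLen_ofAntitone {N : ℕ} {f : ℕ → ℕ} (hf : Antitone f) (h0 : f N = 0) (i : ℕ) :
    (ofAntitone N f hf).rowLen i = f i := by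
  have key : ∀ j, j < (ofAntitone N f hf).rowLen i ↔ j < f i := by
    intro j
    rw [← YoungDiagram.mem_iff_lt_rowLen, ← YoungDiagram.mem_cells]
    simp only [ofAntitone, mem_filter, mem_product, mem_range]
    refine ⟨fun h => h.2, fun h => ⟨⟨?_, h.trans_le (hf (Nat.zero_le i))⟩, h⟩⟩
    by_contra hi
    have := hf (not_lt.1 hi)
    omega
  exact le_antisymm (not_lt.1 fun h => lt_irrefl _ ((key _).1 h))
    (not_lt.1 fun h => lt_irrefl _ ((key _).2 h))

theorem finite_box (N M : ℕ) :
    {mu : YoungDiagram | mu.cells ⊆ range N ×ˢ range M}.Finite := by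
  have : {mu : YoungDiagram | mu.cells ⊆ range N ×ˢ range M} =
      YoungDiagram.cells ⁻¹' ((range N ×ˢ range M).powerset : Set (Finset (ℕ × ℕ))) := by
    ext mu
    simp only [Set.mem_ofPred_eq, Set.mem_preimage, Finset.mem_coe, mem_powerset]
  rw [this]
  exact (Finset.finite_toSet _).preimage fun a _ b _ h => YoungDiagram.ext h

/-- The Young diagrams with at most `N` rows and at most `M` columns. -/
def box (N M : ℕ) : Finset YoungDiagram := (finite_box N M).toFinset

theorem mem_box {N M : ℕ} {mu : YoungDiagram} :
    mu ∈ box N M ↔ mu.rowLen N = 0 ∧ mu.rowLen 0 ≤ M := by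
  simp only [box, Set.Finite.mem_toFinset, Set.mem_ofPred_eq]
  constructor
  · intro h
    constructor
    · by_contra h0
      have : (N, 0) ∈ mu.cells := by
        rw [YoungDiagram.mem_cells, YoungDiagram.mem_iff_lt_rowLen]; omega
      simpa using h this
    · by_contra h0
      have : (0, M) ∈ mu.cells := by
        rw [YoungDiagram.mem_cells, YoungDiagram.mem_iff_lt_rowLen]; omega
      simpa using h this
  · rintro ⟨h1, h2⟩ ⟨i, j⟩ hij
    rw [YoungDiagram.mem_cells, YoungDiagram.mem_iff_lt_rowLen] at hij
    have := mu.rowLen_anti 0 i (Nat.zero_le _)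
    simp only [mem_product, mem_range]
    refine ⟨?_, by omega⟩
    by_contra hN
    have := mu.rowLen_anti N i (not_lt.1 hN)
    omega

theorem rowLen_eq_zero_iff {mu : YoungDiagram} {N : ℕ} : mu.rowLen N = 0 ↔ mu.colLen 0 ≤ N := by
  have := YoungDiagram.mem_iff_lt_rowLen (μ := mu) (i := N) (j := 0)
  rw [YoungDiagram.mem_iff_lt_colLen] at this
  omega

theorem colLen_eq_zero_iff {mu : YoungDiagram} {N : ℕ} : mu.colLen N = 0 ↔ mu.rowLen 0 ≤ N := by
  rw [← YoungDiagram.rowLen_transpose, rowLen_eq_zero_iff, YoungDiagram.colLen_transpose]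

theorem transpose_mem_box {N M : ℕ} {mu : YoungDiagram} :
    mu.transpose ∈ box N M ↔ mu ∈ box M N := by
  rw [mem_box, mem_box, YoungDiagram.rowLen_transpose, YoungDiagram.rowLen_transpose,
    colLen_eq_zero_iff, ← rowLen_eq_zero_iff, and_comm]

theorem box_mono {N M N' M' : ℕ} (h : N ≤ N') (h' : M ≤ M') : box N M ⊆ box N' M' := by
  intro mu hmu
  rw [mem_box] at hmu ⊢
  have := mu.rowLen_anti N N' h
  omega

theorem mem_box_self (mu : YoungDiagram) : mu ∈ box (mu.colLen 0) (mu.rowLen 0) :=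
  mem_box.2 ⟨rowLen_eq_zero_iff.2 le_rfl, le_rfl⟩

theorem exists_subset_box (s : Finset YoungDiagram) : ∃ N₀, ∀ N, N₀ ≤ N → s ⊆ box N N := by
  refine ⟨s.sup fun mu => max (mu.colLen 0) (mu.rowLen 0), fun N hN mu hmu => ?_⟩
  have := (Finset.le_sup (f := fun mu : YoungDiagram => max (mu.colLen 0) (mu.rowLen 0)) hmu)
  exact box_mono (by omega) (by omega) (mem_box_self mu)

theorem rowLen_bot (i : ℕ) : (⊥ : YoungDiagram).rowLen i = 0 := by
  by_contra h
  exact YoungDiagram.notMem_bot (i, 0) (YoungDiagram.mem_iff_lt_rowLen.2 (by omega))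

theorem bot_mem_box (N M : ℕ) : ⊥ ∈ box N M := by simp [mem_box, rowLen_bot]

theorem colLen_bot (i : ℕ) : (⊥ : YoungDiagram).colLen i = 0 := by
  by_contra h
  exact YoungDiagram.notMem_bot (0, i) (YoungDiagram.mem_iff_lt_colLen.2 (by omega))

theorem colLen_zero_eq_zero {mu : YoungDiagram} : mu.colLen 0 = 0 ↔ mu = ⊥ := by
  refine ⟨fun h => rowLen_injective (funext fun i => ?_), fun h => h ▸ colLen_bot 0⟩
  rw [rowLen_bot]
  exact rowLen_eq_zero_iff.2 (by omega)

theorem transpose_bot : (⊥ : YoungDiagram).transpose = ⊥ := by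
  rw [← colLen_zero_eq_zero, YoungDiagram.colLen_transpose, rowLen_bot]

/-- Sums over the cells of a diagram, row by row. -/
theorem sum_cells {A : Type*} [AddCommMonoid A] (nu : YoungDiagram) {N : ℕ} (hN : nu.rowLen N = 0)
    (f : ℕ → ℕ → A) :
    ∑ c ∈ nu.cells, f c.1 c.2 = ∑ i ∈ range N, ∑ j ∈ range (nu.rowLen i), f i j := by
  rw [Finset.sum_sigma']
  refine Finset.sum_nbij' (fun c => ⟨c.1, c.2⟩) (fun c => (c.1, c.2)) ?_ ?_ ?_ ?_ ?_
  · rintro ⟨i, j⟩ h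
    rw [YoungDiagram.mem_cells, YoungDiagram.mem_iff_lt_rowLen] at h
    simp only [mem_sigma, mem_range]
    refine ⟨?_, h⟩
    by_contra hi
    have := nu.rowLen_anti N i (not_lt.1 hi)
    omega
  · rintro ⟨i, j⟩ h
    simp only [mem_sigma, mem_range] at h
    rw [YoungDiagram.mem_cells, YoungDiagram.mem_iff_lt_rowLen]
    exact h.2
  all_goals simp

theorem sum_cells_transpose {A : Type*} [AddCommMonoid A] (nu : YoungDiagram) (f : ℕ → ℕ → A) :
    ∑ c ∈ nu.transpose.cells, f c.1 c.2 = ∑ c ∈ nu.cells, f c.2 c.1 := by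
  refine Finset.sum_nbij' Prod.swap Prod.swap ?_ ?_ ?_ ?_ ?_ <;> simp

theorem card_eq_sum (nu : YoungDiagram) {N : ℕ} (hN : nu.rowLen N = 0) :
    nu.card = ∑ i ∈ range N, nu.rowLen i := by
  have := sum_cells nu hN fun _ _ => (1 : ℕ)
  simpa using this

theorem card_transpose (nu : YoungDiagram) : nu.transpose.card = nu.card := by
  have := sum_cells_transpose nu fun _ _ => (1 : ℕ)
  simpa using this

theorem rowLen_le_card (nu : YoungDiagram) (i : ℕ) : nu.rowLen i ≤ nu.card := by
  rw [YoungDiagram.rowLen_eq_card]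
  exact Finset.card_le_card (Finset.filter_subset _ _)

theorem colLen_le_card (nu : YoungDiagram) (i : ℕ) : nu.colLen i ≤ nu.card := by
  rw [← YoungDiagram.rowLen_transpose, ← card_transpose]
  exact rowLen_le_card _ _

/-! ### Horizontal and vertical strips -/

/-- `lam / mu` is a horizontal strip. -/
def HStrip (mu lam : YoungDiagram) : Prop :=
  mu ≤ lam ∧ ∀ i j, (i + 1, j) ∈ lam → (i, j) ∈ mu

/-- `lam / mu` is a vertical strip. -/
def VStrip (mu lam : YoungDiagram) : Prop :=
  mu ≤ lam ∧ ∀ i j, (i, j + 1) ∈ lam → (i, j) ∈ mu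

theorem le_iff_rowLen {mu lam : YoungDiagram} : mu ≤ lam ↔ ∀ i, mu.rowLen i ≤ lam.rowLen i := by
  constructor
  · intro h i
    by_contra hc
    have h1 : (i, lam.rowLen i) ∈ mu := YoungDiagram.mem_iff_lt_rowLen.2 (by omega)
    have h2 := YoungDiagram.mem_iff_lt_rowLen.1 (h h1)
    omega
  · rintro h ⟨i, j⟩ hij
    exact YoungDiagram.mem_iff_lt_rowLen.2 ((YoungDiagram.mem_iff_lt_rowLen.1 hij).trans_le (h i))

theorem hStrip_iff {mu lam : YoungDiagram} :
    HStrip mu lam ↔ ∀ i, mu.rowLen i ≤ lam.rowLen i ∧ lam.rowLen (i + 1) ≤ mu.rowLen i := by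
  simp only [HStrip, le_iff_rowLen, YoungDiagram.mem_iff_lt_rowLen]
  constructor
  · rintro ⟨h1, h2⟩ i
    refine ⟨h1 i, ?_⟩
    by_contra hc
    have := h2 i (mu.rowLen i) (by omega)
    omega
  · intro h
    exact ⟨fun i => (h i).1, fun i j hij => hij.trans_le (h i).2⟩

theorem vStrip_iff {mu lam : YoungDiagram} :
    VStrip mu lam ↔ ∀ i, mu.rowLen i ≤ lam.rowLen i ∧ lam.rowLen i ≤ mu.rowLen i + 1 := by
  simp only [VStrip, le_iff_rowLen, YoungDiagram.mem_iff_lt_rowLen]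
  constructor
  · rintro ⟨h1, h2⟩ i
    refine ⟨h1 i, ?_⟩
    by_contra hc
    have := h2 i (mu.rowLen i) (by omega)
    omega
  · intro h
    exact ⟨fun i => (h i).1, fun i j hij => by have := (h i).2; omega⟩

/-- This matches the branching rule in one alphabet (horizontal strips) with the Pieri rule in the
other (vertical strips), as the dual Cauchy identity requires. -/
theorem hStrip_transpose {mu lam : YoungDiagram} :
    HStrip mu.transpose lam.transpose ↔ VStrip mu lam := by
  simp only [HStrip, VStrip, YoungDiagram.transpose_le_iff, YoungDiagram.mem_transpose,
    Prod.swap_prod_mk]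
  exact and_congr_right fun _ => forall_comm

/-! ### Jacobi–Trudi determinants -/

section JacobiTrudi

variable {R : Type*} [CommRing R]

/-- The coefficients of a power series, extended by zero to negative indices. -/
def intCoeff (f : PowerSeries R) : ℤ → R
  | Int.ofNat r => PowerSeries.coeff r f
  | Int.negSucc _ => 0

theorem intCoeff_natCast (f : PowerSeries R) (r : ℕ) :
    intCoeff f (r : ℤ) = PowerSeries.coeff r f := rfl

theorem intCoeff_of_neg (f : PowerSeries R) {r : ℤ} (hr : r < 0) : intCoeff f r = 0 := by
  obtain ⟨k, rfl⟩ := Int.eq_negSucc_of_lt_zero hr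
  rfl

theorem intCoeff_zero (f : PowerSeries R) : intCoeff f 0 = PowerSeries.constantCoeff f := by
  have := intCoeff_natCast f 0
  simpa using this

/-- The Jacobi–Trudi determinant of size `L`. -/
def jacobiTrudi (h : ℤ → R) (L : ℕ) (lam : YoungDiagram) : R :=
  (Matrix.of fun i j : Fin L => h ((lam.rowLen i : ℤ) - (i : ℤ) + (j : ℤ))).det

/-- When λ_{L+1} = 0 the last row of the larger matrix is (0, …, 0, 1). -/
theorem jacobiTrudi_succ {h : ℤ → R} (h0 : h 0 = 1) (hneg : ∀ r < 0, h r = 0) {L : ℕ}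
    {lam : YoungDiagram} (hL : lam.rowLen L = 0) :
    jacobiTrudi h (L + 1) lam = jacobiTrudi h L lam := by
  rw [jacobiTrudi, Matrix.det_succ_row _ (Fin.last L), Fin.sum_univ_castSucc,
    Finset.sum_eq_zero, zero_add]
  · simp only [Matrix.of_apply, Fin.val_last, hL]
    rw [show ((0 : ℕ) : ℤ) - (L : ℤ) + (L : ℤ) = 0 by ring, h0, ← two_mul, pow_mul]
    simp only [Fin.succAbove_last]
    simp [jacobiTrudi, Matrix.submatrix]
  · intro j _
    simp only [Matrix.of_apply, Fin.val_last, hL, Fin.val_castSucc]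
    rw [hneg _ (by have := j.2; omega)]
    simp

theorem jacobiTrudi_eq_of_le {h : ℤ → R} (h0 : h 0 = 1) (hneg : ∀ r < 0, h r = 0) {L : ℕ}
    {lam : YoungDiagram} (hL : lam.rowLen L = 0) :
    jacobiTrudi h L lam = jacobiTrudi h (lam.colLen 0) lam := by
  rw [rowLen_eq_zero_iff] at hL
  induction L, hL using Nat.le_induction with
  | base => rfl
  | succ n hn ih => rw [jacobiTrudi_succ h0 hneg (rowLen_eq_zero_iff.2 hn), ih]

theorem jacobiTrudi_bot {h : ℤ → R} (h0 : h 0 = 1) (hneg : ∀ r < 0, h r = 0) (L : ℕ) :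
    jacobiTrudi h L ⊥ = 1 := by
  rw [jacobiTrudi_eq_of_le h0 hneg (rowLen_bot L), colLen_bot]
  simp [jacobiTrudi]

theorem det_eq_of_forall_row_eq_smul_add_succ {n : ℕ} {A B : Matrix (Fin (n + 1)) (Fin (n + 1)) R}
    (c : Fin n → R) (hlast : ∀ j, A (Fin.last n) j = B (Fin.last n) j)
    (h : ∀ (i : Fin n) (j), A i.castSucc j = B i.castSucc j + c i * A i.succ j) :
    A.det = B.det := by
  rw [← Matrix.det_submatrix_equiv_self Fin.revPerm A,
    ← Matrix.det_submatrix_equiv_self Fin.revPerm B]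
  refine Matrix.det_eq_of_forall_row_eq_smul_add_pred (fun i => c i.rev) ?_ ?_
  · intro j
    simp [hlast]
  · intro i j
    simp [Fin.rev_succ, Fin.rev_castSucc, h]

theorem det_sum_rows {L : ℕ} (S : Fin L → Finset ℕ) (F : Fin L → ℕ → Fin L → R) :
    (Matrix.of fun i j : Fin L => ∑ m ∈ S i, F i m j).det =
      ∑ k ∈ Fintype.piFinset S, (Matrix.of fun i j : Fin L => F i (k i) j).det := by
  have h : (Matrix.of fun i j : Fin L => ∑ m ∈ S i, F i m j) =
      Matrix.of fun i : Fin L => ∑ m ∈ S i, F i m := by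
    ext i j
    simp
  rw [h]
  exact MultilinearMap.map_sum_finset
    (Matrix.detRowAlternating (n := Fin L) (R := R)).toMultilinearMap F S

/-- Here g = f / (1 - yX); this is the effect of adjoining one variable y to the complete symmetric
polynomials. -/
theorem intCoeff_eq_of_mul {f g : PowerSeries R} {y : R}
    (hfg : g * (1 - PowerSeries.C y * PowerSeries.X) = f) (r : ℤ) :
    intCoeff g r = intCoeff f r + y * intCoeff g (r - 1) := by
  rcases lt_or_ge r 0 with hr | hr
  · simp [intCoeff_of_neg _ hr, intCoeff_of_neg g (show r - 1 < 0 by omega)]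
  obtain ⟨k, rfl⟩ := Int.eq_ofNat_of_zero_le hr
  rw [← hfg, mul_sub, mul_one, show g * (PowerSeries.C y * PowerSeries.X) =
    PowerSeries.C y * g * PowerSeries.X by ring]
  rcases k with _ | k
  · simp [intCoeff_zero, intCoeff_of_neg]
  · rw [show ((k + 1 : ℕ) : ℤ) - 1 = (k : ℤ) by push_cast; ring]
    simp only [intCoeff_natCast, map_sub, PowerSeries.coeff_succ_mul_X, PowerSeries.coeff_C_mul]
    ring

/-- The recursion is unrolled from a down to b; the last term is the remainder that a row operation
removes in the branching rule. -/
theorem intCoeff_eq_sum {f g : PowerSeries R} {y : R}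
    (hfg : g * (1 - PowerSeries.C y * PowerSeries.X) = f) (t : ℤ) {b a : ℕ} (hab : b ≤ a) :
    intCoeff g ((a : ℤ) + t) =
      (∑ m ∈ Icc b a, y ^ (a - m) * intCoeff f ((m : ℤ) + t)) +
        y ^ (a - b + 1) * intCoeff g ((b : ℤ) - 1 + t) := by
  induction a, hab using Nat.le_induction with
  | base =>
    simp [intCoeff_eq_of_mul hfg ((b : ℤ) + t), add_sub_right_comm]
  | succ a hab ih =>
    rw [intCoeff_eq_of_mul hfg, show ((a + 1 : ℕ) : ℤ) + t - 1 = (a : ℤ) + t by push_cast; ring, ih,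
      ← Finset.insert_Icc_right_eq_Icc_add_one (by omega : b ≤ a + 1), Finset.sum_insert (by simp),
      Nat.sub_self, pow_zero, one_mul, add_assoc, mul_add, Finset.mul_sum]
    congr 2
    · refine Finset.sum_congr rfl fun m hm => ?_
      rw [Nat.succ_sub (Finset.mem_Icc.1 hm).2, pow_succ]
      ring
    · rw [show a + 1 - b + 1 = (a - b + 1) + 1 by omega, pow_succ]
      ring

open Classical in
/-- The branching rule for Jacobi–Trudi determinants. -/
theorem jacobiTrudi_branching {f g : PowerSeries R} {y : R}
    (hfg : g * (1 - PowerSeries.C y * PowerSeries.X) = f) {L M : ℕ} {lam : YoungDiagram}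
    (hlam : lam ∈ box L M) :
    jacobiTrudi (intCoeff g) L lam =
      ∑ mu ∈ (box L M).filter (fun mu => HStrip mu lam),
        y ^ (lam.card - mu.card) * jacobiTrudi (intCoeff f) L mu := by
  obtain ⟨hL, hM⟩ := mem_box.1 hlam
  -- Unrolling row i down to b = λ_{i+1} leaves a multiple of g at λ_{i+1} - 1 - i + j, which is the
  -- entry of row i + 1 in the same column, so a row operation removes it. In the last row b = 0 and
  -- the remainder has negative index.
  have h1 : jacobiTrudi (intCoeff g) L lam = (Matrix.of fun i j : Fin L =>
      ∑ m ∈ Icc (lam.rowLen (i + 1)) (lam.rowLen i),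
        y ^ (lam.rowLen i - m) * intCoeff f ((m : ℤ) + (-(i : ℤ) + (j : ℤ)))).det := by
    rcases L with _ | n
    · simp [jacobiTrudi]
    refine det_eq_of_forall_row_eq_smul_add_succ
      (fun i => y ^ (lam.rowLen i - lam.rowLen (i + 1) + 1)) (fun j => ?_) (fun i j => ?_)
    · simp only [Matrix.of_apply, Fin.val_last, hL]
      rw [sub_add, sub_eq_add_neg, show -((n : ℤ) - (j : ℤ)) = -(n : ℤ) + j by ring,
        intCoeff_eq_sum hfg _ (Nat.zero_le _), intCoeff_of_neg g, mul_zero, add_zero]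
      have := j.2
      push_cast
      omega
    · simp only [Matrix.of_apply, Fin.val_castSucc, Fin.val_succ]
      rw [sub_add, sub_eq_add_neg, show -((i : ℤ) - (j : ℤ)) = -(i : ℤ) + j by ring,
        intCoeff_eq_sum hfg _ (lam.rowLen_anti i (i + 1) (Nat.le_succ _))]
      congr 3
      push_cast
      ring
  rw [h1, det_sum_rows]
  -- Multilinearity leaves one determinant for each choice of m_i in [λ_{i+1}, λ_i]. Such choices
  -- interlace with λ, so they are the rows of the diagrams μ with λ/μ a horizontal strip.
  have hext : ∀ k ∈ Fintype.piFinset fun i : Fin L => Icc (lam.rowLen (i + 1)) (lam.rowLen i),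
      ∃ mu : YoungDiagram, mu ∈ (box L M).filter (fun mu => HStrip mu lam) ∧
        ∀ i : Fin L, mu.rowLen i = k i := by
    intro k hk
    simp only [Fintype.mem_piFinset, mem_Icc] at hk
    have hanti : Antitone fun i : ℕ => if h : i < L then k ⟨i, h⟩ else 0 := by
      refine antitone_nat_of_succ_le fun i => ?_
      by_cases hi : i + 1 < L
      · have e1 := (hk ⟨i + 1, hi⟩).2
        have e2 := (hk ⟨i, by omega⟩).1
        simp only [hi, show i < L by omega, dite_true]
        exact e1.trans e2
      · simp [hi]
    have hrow := rowLen_ofAntitone (N := L) hanti (by simp)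
    have hHS : HStrip (ofAntitone L _ hanti) lam := by
      rw [hStrip_iff]
      intro i
      rw [hrow]
      by_cases hi : i < L
      · simpa [hi] using (hk ⟨i, hi⟩).symm
      · have := lam.rowLen_anti L (i + 1) (by omega)
        simp only [hi, dite_false]
        omega
    refine ⟨ofAntitone L _ hanti, mem_filter.2 ⟨mem_box.2 ⟨?_, ?_⟩, hHS⟩, fun i => ?_⟩
    · rw [hrow]; simp
    · exact ((hStrip_iff.1 hHS 0).1).trans hM
    · rw [hrow]; simp
  symm
  refine Finset.sum_bij (fun mu _ i => mu.rowLen i) ?_ ?_ ?_ ?_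
  · intro mu hmu
    rw [mem_filter, hStrip_iff] at hmu
    simp only [Fintype.mem_piFinset, mem_Icc]
    exact fun i => (hmu.2 i).symm
  · intro mu hmu mu' hmu' heq
    rw [mem_filter, mem_box] at hmu hmu'
    refine rowLen_injective (funext fun i => ?_)
    by_cases hi : i < L
    · exact congrFun heq ⟨i, hi⟩
    · have e1 := mu.rowLen_anti L i (by omega)
      have e2 := mu'.rowLen_anti L i (by omega)
      omega
  · intro k hk
    obtain ⟨mu, h, h'⟩ := hext k hk
    exact ⟨mu, h, funext h'⟩
  · intro mu hmu
    rw [mem_filter, mem_box, hStrip_iff] at hmu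
    have e1 := Matrix.det_mul_column (fun i : Fin L => y ^ (lam.rowLen i - mu.rowLen i))
      (Matrix.of fun i j : Fin L => intCoeff f ((mu.rowLen i : ℤ) + (-(i : ℤ) + (j : ℤ))))
    have e2 : lam.card - mu.card = ∑ i : Fin L, (lam.rowLen i - mu.rowLen i) := by
      rw [card_eq_sum lam hL, card_eq_sum mu hmu.1.1, Fin.sum_univ_eq_sum_range
        (fun i => lam.rowLen i - mu.rowLen i), Finset.sum_tsub_distrib _ fun i _ => (hmu.2 i).1]
    rw [e2, ← Finset.prod_pow_eq_pow_sum, jacobiTrudi]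
    simp only [sub_eq_add_neg, add_assoc, Matrix.of_apply] at e1 ⊢
    exact e1.symm

end JacobiTrudi

/-! ### Schur polynomials in finitely many variables -/

section FiniteVariables

variable {R : Type*} [CommRing R]

/-- The generating series `∏_{i < N} (1 - x_i t)⁻¹` of the complete symmetric polynomials. -/
def geomProd (x : ℕ → R) (N : ℕ) : PowerSeries R :=
  ∏ i ∈ range N, PowerSeries.mk fun r => x i ^ r

theorem geom_mul (a : R) :
    (PowerSeries.mk fun r => a ^ r) * (1 - PowerSeries.C a * PowerSeries.X) = 1 := by
  rw [mul_sub, mul_one, show (PowerSeries.mk fun r => a ^ r) * (PowerSeries.C a * PowerSeries.X) =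
    PowerSeries.C a * (PowerSeries.mk fun r => a ^ r) * PowerSeries.X by ring]
  ext r
  rcases r with _ | r
  · simp
  · rw [map_sub, PowerSeries.coeff_succ_mul_X, PowerSeries.coeff_C_mul]
    simp [PowerSeries.coeff_one, pow_succ']

theorem geomProd_succ_mul (x : ℕ → R) (N : ℕ) :
    geomProd x (N + 1) * (1 - PowerSeries.C (x N) * PowerSeries.X) = geomProd x N := by
  rw [geomProd, Finset.prod_range_succ, mul_assoc, geom_mul, mul_one, geomProd]

theorem intCoeff_geomProd_zero (x : ℕ → R) (N : ℕ) : intCoeff (geomProd x N) 0 = 1 := by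
  rw [intCoeff_zero, geomProd, map_prod]
  refine Finset.prod_eq_one fun i _ => ?_
  simp [← PowerSeries.coeff_zero_eq_constantCoeff_apply]

/-- The Schur polynomial in the variables `x_0, …, x_{N-1}`. -/
def schurFin (x : ℕ → R) (N : ℕ) (lam : YoungDiagram) : R :=
  jacobiTrudi (intCoeff (geomProd x N)) (lam.colLen 0) lam

theorem jacobiTrudi_eq_schurFin (x : ℕ → R) (N : ℕ) {L : ℕ} {lam : YoungDiagram}
    (hL : lam.rowLen L = 0) :
    jacobiTrudi (intCoeff (geomProd x N)) L lam = schurFin x N lam :=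
  jacobiTrudi_eq_of_le (intCoeff_geomProd_zero x N) (fun _ => intCoeff_of_neg _) hL

open Classical in
theorem schurFin_succ (x : ℕ → R) (N : ℕ) {L M : ℕ} {lam : YoungDiagram} (hlam : lam ∈ box L M) :
    schurFin x (N + 1) lam = ∑ mu ∈ (box L M).filter (fun mu => HStrip mu lam),
      x N ^ (lam.card - mu.card) * schurFin x N mu := by
  rw [← jacobiTrudi_eq_schurFin x _ (mem_box.1 hlam).1,
    jacobiTrudi_branching (geomProd_succ_mul x N) hlam]
  refine Finset.sum_congr rfl fun mu hmu => ?_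
  rw [jacobiTrudi_eq_schurFin x _ (mem_box.1 (mem_filter.1 hmu).1).1]

theorem schurFin_bot (x : ℕ → R) (N : ℕ) : schurFin x N ⊥ = 1 :=
  jacobiTrudi_bot (intCoeff_geomProd_zero x N) (fun _ => intCoeff_of_neg _) _

/-- All indices in the first row are positive, as λ_1 ≥ 1. -/
theorem jacobiTrudi_eq_zero {h : ℤ → R} (hpos : ∀ r > 0, h r = 0) {lam : YoungDiagram}
    (hlam : lam ≠ ⊥) : jacobiTrudi h (lam.colLen 0) lam = 0 := by
  have h0 : 0 < lam.colLen 0 := Nat.pos_of_ne_zero fun h => hlam (colLen_zero_eq_zero.1 h)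
  refine Matrix.det_eq_zero_of_row_eq_zero ⟨0, h0⟩ fun j => ?_
  rw [← YoungDiagram.mem_iff_lt_colLen, YoungDiagram.mem_iff_lt_rowLen] at h0
  simp only [Matrix.of_apply]
  exact hpos _ (by push_cast; omega)

theorem schurFin_zero (x : ℕ → R) {lam : YoungDiagram} (hlam : lam ≠ ⊥) :
    schurFin x 0 lam = 0 := by
  refine jacobiTrudi_eq_zero (fun r hr => ?_) hlam
  lift r to ℕ using hr.le
  rw [intCoeff_natCast, geomProd, Finset.range_zero, Finset.prod_empty, PowerSeries.coeff_one,
    if_neg (by omega)]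

/-- Each variable adds a horizontal strip, hence at most one row. -/
theorem schurFin_eq_zero_of_lt (x : ℕ → R) {N : ℕ} {lam : YoungDiagram} (h : N < lam.colLen 0) :
    schurFin x N lam = 0 := by
  induction N generalizing lam with
  | zero =>
    refine schurFin_zero x fun hb => ?_
    rw [hb, colLen_bot] at h
    omega
  | succ N ih =>
    classical
    rw [schurFin_succ x N (mem_box_self lam)]
    refine Finset.sum_eq_zero fun mu hmu => ?_
    rw [ih, mul_zero]
    have h1 := (hStrip_iff.1 (mem_filter.1 hmu).2 N).2
    rw [← YoungDiagram.mem_iff_lt_colLen, YoungDiagram.mem_iff_lt_rowLen] at h ⊢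
    omega

theorem schurFin_nonneg {x : ℕ → ℝ} (hx : ∀ i, 0 ≤ x i) (N : ℕ) (lam : YoungDiagram) :
    0 ≤ schurFin x N lam := by
  induction N generalizing lam with
  | zero =>
    by_cases h : lam = ⊥
    · rw [h, schurFin_bot]; exact zero_le_one
    · rw [schurFin_zero x h]
  | succ N ih =>
    classical
    rw [schurFin_succ x N (mem_box_self lam)]
    exact Finset.sum_nonneg fun mu _ => mul_nonneg (pow_nonneg (hx N) _) (ih mu)

theorem norm_schurFin_le (x : ℕ → ℂ) (N : ℕ) (lam : YoungDiagram) :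
    ‖schurFin x N lam‖ ≤ schurFin (fun i => ‖x i‖) N lam := by
  induction N generalizing lam with
  | zero =>
    by_cases h : lam = ⊥
    · rw [h, schurFin_bot, schurFin_bot, norm_one]
    · rw [schurFin_zero _ h, schurFin_zero _ h, norm_zero]
  | succ N ih =>
    classical
    rw [schurFin_succ x N (mem_box_self lam), schurFin_succ _ N (mem_box_self lam)]
    refine (norm_sum_le _ _).trans (Finset.sum_le_sum fun mu _ => ?_)
    rw [norm_mul, norm_pow]
    exact mul_le_mul_of_nonneg_left (ih mu) (pow_nonneg (norm_nonneg _) _)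

/-- The right side is the left side, as the term μ = λ of the branching rule, plus nonnegative
terms. -/
theorem schurFin_le_succ {x : ℕ → ℝ} (hx : ∀ i, 0 ≤ x i) (N : ℕ) (lam : YoungDiagram) :
    schurFin x N lam ≤ schurFin x (N + 1) lam := by
  classical
  rw [schurFin_succ x N (mem_box_self lam)]
  have hself : HStrip lam lam :=
    ⟨le_rfl, fun i j h => lam.up_left_mem (Nat.le_succ i) le_rfl h⟩
  have h := Finset.single_le_sum
    (f := fun mu : YoungDiagram => x N ^ (lam.card - mu.card) * schurFin x N mu)
    (fun mu _ => mul_nonneg (pow_nonneg (hx N) _) (schurFin_nonneg hx N mu))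
    (show lam ∈ (box (lam.colLen 0) (lam.rowLen 0)).filter (fun mu => HStrip mu lam) from
      mem_filter.2 ⟨mem_box_self lam, hself⟩)
  simpa using h

/-! ### Bialternant formula, Pieri rule and dual Cauchy identity -/

/-- The alternant `det (x_l^{λ_i + N - 1 - i})`. -/
def alternant (x : ℕ → R) (N : ℕ) (lam : YoungDiagram) : R :=
  (Matrix.of fun i l : Fin N => x l ^ (lam.rowLen i + (N - 1 - i))).det

theorem sum_intCoeff_mul (f P : PowerSeries R) {N : ℕ}
    (hP : ∀ m, N ≤ m → PowerSeries.coeff m P = 0) (a : ℕ) :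
    ∑ m ∈ range N, intCoeff f ((a : ℤ) - m) * PowerSeries.coeff m P =
      PowerSeries.coeff a (f * P) := by
  rw [mul_comm f P, PowerSeries.coeff_mul, Finset.Nat.sum_antidiagonal_eq_sum_range_succ
    (fun i j => PowerSeries.coeff i P * PowerSeries.coeff j f),
    Finset.sum_subset (Finset.range_mono (Nat.le_add_right N (a + 1))),
    ← Finset.sum_subset (Finset.range_mono (Nat.le_add_left (a + 1) N))]
  · refine Finset.sum_congr rfl fun m hm => ?_
    have := Finset.mem_range.1 hm
    rw [← Nat.cast_sub (by omega), intCoeff_natCast, mul_comm]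
  · intro m _ hm
    rw [Finset.mem_range] at hm
    rw [intCoeff_of_neg f (by omega), zero_mul]
  · intro m _ hm
    rw [Finset.mem_range] at hm
    rw [hP m (by omega), mul_zero]

/-- Multiplying ∏ (1 - x_k t)⁻¹ by P_l = ∏_{k ≠ l} (1 - x_k t) leaves (1 - x_l t)⁻¹. Comparing
coefficients writes the alternant matrix as the Jacobi–Trudi matrix times a matrix of coefficients
of the P_l, which does not involve λ. -/
theorem alternant_eq_mul (x : ℕ → R) (N : ℕ) :
    ∃ D : R, ∀ lam : YoungDiagram, lam.rowLen N = 0 →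
      alternant x N lam = schurFin x N lam * D := by
  let P : Fin N → Polynomial R := fun l =>
    ∏ k ∈ (univ : Finset (Fin N)).erase l, (1 - Polynomial.C (x k) * Polynomial.X)
  have hdeg : ∀ l m, N ≤ m → PowerSeries.coeff m (P l : PowerSeries R) = 0 := by
    intro l m hm
    rw [Polynomial.coeff_coe]
    refine Polynomial.coeff_eq_zero_of_natDegree_lt ?_
    have h1 : (P l).natDegree ≤ ∑ k ∈ (univ : Finset (Fin N)).erase l, 1 := by
      refine (Polynomial.natDegree_prod_le _ _).trans (Finset.sum_le_sum fun k _ => ?_)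
      compute_degree
    rw [Finset.sum_const, Finset.card_erase_of_mem (mem_univ _), Finset.card_fin, smul_eq_mul] at h1
    have := l.2
    omega
  have hmul : ∀ l, geomProd x N * (P l : PowerSeries R) = PowerSeries.mk fun r => x l ^ r := by
    intro l
    have h1 : (P l : PowerSeries R) = ∏ k ∈ (univ : Finset (Fin N)).erase l,
        (1 - PowerSeries.C (x k) * PowerSeries.X) := by
      rw [← Polynomial.coeToPowerSeries.ringHom_apply, map_prod]
      simp
    rw [h1, geomProd, ← Fin.prod_univ_eq_prod_range (fun i => PowerSeries.mk fun r => x i ^ r),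
      ← Finset.mul_prod_erase _ _ (mem_univ l), mul_assoc, ← Finset.prod_mul_distrib,
      Finset.prod_eq_one (fun k _ => geom_mul _), mul_one]
  refine ⟨(Matrix.of fun m l : Fin N => PowerSeries.coeff (N - 1 - m) (P l : PowerSeries R)).det,
    fun lam hlam => ?_⟩
  rw [← jacobiTrudi_eq_schurFin x N hlam, jacobiTrudi, ← Matrix.det_mul, alternant]
  congr 1
  ext i l
  simp only [Matrix.of_apply, Matrix.mul_apply]
  have h2 := sum_intCoeff_mul (geomProd x N) (P l) (hdeg l) (lam.rowLen i + (N - 1 - i))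
  rw [hmul, PowerSeries.coeff_mk] at h2
  -- The sum is reversed so that column m of the Jacobi–Trudi matrix meets the coefficient of degree
  -- N - 1 - m.
  rw [← h2, ← Finset.sum_range_reflect, ← Fin.sum_univ_eq_sum_range (fun j : ℕ =>
    intCoeff (geomProd x N) (((lam.rowLen i + (N - 1 - i) : ℕ) : ℤ) - ((N - 1 - j : ℕ) : ℤ)) *
      PowerSeries.coeff (N - 1 - j) (P l : PowerSeries R))]
  refine Finset.sum_congr rfl fun m _ => ?_
  congr 2
  have := i.2
  have := m.2
  omega

/-- The bialternant formula, without division. -/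
theorem alternant_eq (x : ℕ → R) (N : ℕ) {lam : YoungDiagram} (hlam : lam.rowLen N = 0) :
    alternant x N lam = schurFin x N lam * alternant x N ⊥ := by
  obtain ⟨D, hD⟩ := alternant_eq_mul x N
  rw [hD lam hlam, hD ⊥ (rowLen_bot N), schurFin_bot, one_mul]

open Classical in
/-- The Pieri rule for alternants. -/
theorem alternant_mul_prod (x : ℕ → R) (y : R) {N M : ℕ} {mu : YoungDiagram} (hmu : mu ∈ box N M) :
    alternant x N mu * ∏ i ∈ range N, (1 + x i * y) =
      ∑ lam ∈ (box N (M + 1)).filter (fun lam => VStrip mu lam),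
        y ^ (lam.card - mu.card) * alternant x N lam := by
  obtain ⟨hN, hM⟩ := mem_box.1 hmu
  have h1 : alternant x N mu * ∏ i ∈ range N, (1 + x i * y) =
      (Matrix.of fun i l : Fin N => ∑ m ∈ range 2,
        y ^ m * x l ^ (mu.rowLen i + (N - 1 - i) + m)).det := by
    rw [mul_comm, ← Fin.prod_univ_eq_prod_range (fun i => 1 + x i * y), alternant,
      ← Matrix.det_mul_row]
    congr 1
    ext i l
    simp only [Matrix.of_apply, Finset.sum_range_succ, Finset.sum_range_zero]
    ring
  rw [h1, det_sum_rows (fun _ => range 2)]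
  symm
  refine Finset.sum_of_injOn (fun lam i => lam.rowLen i - mu.rowLen i) ?_ ?_ ?_ ?_
  · intro lam hlam lam' hlam' heq
    rw [mem_coe, mem_filter, mem_box, vStrip_iff] at hlam hlam'
    refine rowLen_injective (funext fun i => ?_)
    by_cases hi : i < N
    · have e1 := congrFun heq ⟨i, hi⟩
      have := hlam.2 i
      have := hlam'.2 i
      simp only at e1
      omega
    · have e1 := lam.rowLen_anti N i (by omega)
      have e2 := lam'.rowLen_anti N i (by omega)
      omega
  · intro lam hlam
    rw [mem_coe, mem_filter, vStrip_iff] at hlam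
    simp only [mem_coe, Fintype.mem_piFinset, mem_range]
    intro i
    have := hlam.2 i
    omega
  · intro k hk hnot
    simp only [Fintype.mem_piFinset, mem_range] at hk
    by_cases hanti : Antitone fun i : ℕ => if h : i < N then mu.rowLen i + k ⟨i, h⟩ else 0
    · exfalso
      apply hnot
      have hrow := rowLen_ofAntitone (N := N) hanti (by simp)
      have hVS : VStrip mu (ofAntitone N _ hanti) := by
        rw [vStrip_iff]
        intro i
        rw [hrow]
        by_cases hi : i < N
        · have := hk ⟨i, hi⟩
          simp only [hi, dite_true]
          omega
        · have := mu.rowLen_anti N i (by omega)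
          simp only [hi, dite_false]
          omega
      refine ⟨ofAntitone N _ hanti, mem_coe.2 (mem_filter.2 ⟨mem_box.2 ⟨?_, ?_⟩, hVS⟩), ?_⟩
      · rw [hrow]; simp
      · have := (vStrip_iff.1 hVS 0).2
        omega
      · funext ⟨i, hi⟩
        simp only [hrow, hi, dite_true]
        omega
    -- If adding k to μ does not give a partition, then μ_i = μ_{i+1}, k_i = 0 and k_{i+1} = 1 for
    -- some i. The shift N - 1 - i makes the exponents of these two rows equal, so the determinant
    -- vanishes.
    · have : ∃ i : ℕ, ∃ h : i + 1 < N, mu.rowLen i + k ⟨i, by omega⟩ <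
          mu.rowLen (i + 1) + k ⟨i + 1, h⟩ := by
        by_contra hc
        push Not at hc
        refine hanti (antitone_nat_of_succ_le fun i => ?_)
        by_cases hi : i + 1 < N
        · simpa [hi, show i < N by omega] using hc i hi
        · simp [hi]
      obtain ⟨i, hi, hlt⟩ := this
      have h2 := mu.rowLen_anti i (i + 1) (Nat.le_succ i)
      have h3 := hk ⟨i + 1, hi⟩
      have hk0 : k ⟨i, by omega⟩ = 0 := by omega
      have hk1 : k ⟨i + 1, hi⟩ = 1 := by omega
      have e1 := Matrix.det_mul_column (fun i : Fin N => y ^ k i)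
        (Matrix.of fun i l : Fin N => x l ^ (mu.rowLen i + (N - 1 - i) + k i))
      simp only [Matrix.of_apply] at e1
      rw [e1, Matrix.det_zero_of_row_eq (i := ⟨i, by omega⟩) (j := ⟨i + 1, hi⟩), mul_zero]
      · intro h
        simp at h
      · funext l
        simp only [Matrix.of_apply, hk0, hk1]
        congr 1
        omega
  · intro lam hlam
    rw [mem_filter, mem_box, vStrip_iff] at hlam
    have e1 := Matrix.det_mul_column (fun i : Fin N => y ^ (lam.rowLen i - mu.rowLen i))
      (Matrix.of fun i l : Fin N => x l ^ (lam.rowLen i + (N - 1 - i)))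
    have e2 : lam.card - mu.card = ∑ i : Fin N, (lam.rowLen i - mu.rowLen i) := by
      rw [card_eq_sum lam hlam.1.1, card_eq_sum mu hN, Fin.sum_univ_eq_sum_range
        (fun i => lam.rowLen i - mu.rowLen i),
        Finset.sum_tsub_distrib _ fun i _ => (hlam.2 i).1]
    rw [e2, ← Finset.prod_pow_eq_pow_sum, alternant, ← e1]
    congr 1
    ext i l
    simp only [Matrix.of_apply]
    have := (hlam.2 i).1
    congr 2
    omega

/-- This is a Vandermonde determinant with its rows reversed. -/
theorem alternant_bot_ne_zero [IsDomain R] {x : ℕ → R} (hx : Function.Injective x) (N : ℕ) :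
    alternant x N ⊥ ≠ 0 := by
  have h : alternant x N ⊥ = ((Matrix.vandermonde fun l : Fin N => x l).transpose.submatrix
      Fin.revPerm id).det := by
    rw [alternant]
    congr 1
    ext i l
    simp only [Matrix.of_apply, Matrix.submatrix_apply, Matrix.transpose_apply,
      Matrix.vandermonde_apply, rowLen_bot, Fin.revPerm_apply, Fin.val_rev, id]
    congr 1
    omega
  rw [h, Matrix.det_permute, Matrix.det_transpose]
  refine mul_ne_zero ?_ (Matrix.det_vandermonde_ne_zero_iff.2 fun a b hab => Fin.ext (hx hab))
  rcases Int.units_eq_one_or (Equiv.Perm.sign (Fin.revPerm (n := N))) with h | h <;> simp [h]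

open Classical in
-- The Pieri rule for alternants is divided by the Vandermonde determinant; this is why distinct
-- variables in a domain are assumed here and below.
theorem schurFin_mul_prod [IsDomain R] {x : ℕ → R} (hx : Function.Injective x) (y : R) {N M : ℕ}
    {mu : YoungDiagram} (hmu : mu ∈ box N M) :
    schurFin x N mu * ∏ i ∈ range N, (1 + x i * y) =
      ∑ lam ∈ (box N (M + 1)).filter (fun lam => VStrip mu lam),
        y ^ (lam.card - mu.card) * schurFin x N lam := by
  refine mul_right_cancel₀ (alternant_bot_ne_zero hx N) ?_
  rw [mul_right_comm, ← alternant_eq x N (mem_box.1 hmu).1, alternant_mul_prod x y hmu,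
    Finset.sum_mul]
  refine Finset.sum_congr rfl fun lam hlam => ?_
  rw [alternant_eq x N (mem_box.1 (mem_filter.1 hlam).1).1, mul_assoc]

/-- The dual Cauchy identity in finitely many variables. -/
theorem dual_cauchy_fin [IsDomain R] {x : ℕ → R} (hx : Function.Injective x) (y : ℕ → R)
    (N M : ℕ) :
    ∑ mu ∈ box N M, schurFin x N mu * schurFin y M mu.transpose =
      ∏ i ∈ range N, ∏ j ∈ range M, (1 + x i * y j) := by
  classical
  induction M with
  | zero =>
    have : box N 0 = {⊥} := by
      ext mu
      rw [mem_singleton]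
      constructor
      · intro h
        rw [← transpose_mem_box, mem_box, rowLen_eq_zero_iff.trans Nat.le_zero,
          colLen_zero_eq_zero] at h
        rw [← mu.transpose_transpose, h.1, transpose_bot]
      · rintro rfl
        exact bot_mem_box N 0
    simp [this, transpose_bot, schurFin_bot]
  | succ M ih =>
    have h1 : ∀ lam ∈ box N (M + 1), schurFin y (M + 1) lam.transpose =
        ∑ mu ∈ box N (M + 1), if VStrip mu lam then
          y M ^ (lam.card - mu.card) * schurFin y M mu.transpose else 0 := by
      intro lam hlam
      rw [schurFin_succ y M (transpose_mem_box.2 hlam), Finset.sum_filter]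
      refine Finset.sum_nbij' YoungDiagram.transpose YoungDiagram.transpose ?_ ?_ ?_ ?_ ?_
      · exact fun mu hmu => transpose_mem_box.2 hmu
      · exact fun mu hmu => transpose_mem_box.2 hmu
      · simp
      · simp
      · intro mu _
        have h2 := hStrip_transpose (mu := mu.transpose) (lam := lam)
        rw [mu.transpose_transpose] at h2
        simp only [h2, card_transpose, mu.transpose_transpose]
    -- After the branching rule in y_M, the sum over λ for fixed μ is the Pieri rule with y = y_M.
    -- If μ has M + 1 columns, both sides vanish because μ^t has too many rows for M variables.
    have h3 : ∀ mu ∈ box N (M + 1), ∑ lam ∈ box N (M + 1), schurFin x N lam *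
        (if VStrip mu lam then y M ^ (lam.card - mu.card) * schurFin y M mu.transpose else 0) =
        schurFin x N mu * schurFin y M mu.transpose * ∏ i ∈ range N, (1 + x i * y M) := by
      intro mu hmu
      by_cases hmu' : mu ∈ box N M
      · rw [mul_right_comm, schurFin_mul_prod hx _ hmu', Finset.sum_filter, Finset.sum_mul]
        refine Finset.sum_congr rfl fun lam _ => ?_
        split_ifs <;> ring
      · have : schurFin y M mu.transpose = 0 := by
          refine schurFin_eq_zero_of_lt y ?_
          rw [mem_box] at hmu hmu'
          rw [YoungDiagram.colLen_transpose]
          omega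
        simp [this]
    rw [Finset.sum_congr rfl fun lam hlam => by rw [h1 lam hlam, Finset.mul_sum],
      Finset.sum_comm, Finset.sum_congr rfl h3, ← Finset.sum_mul]
    have h4 : ∑ mu ∈ box N (M + 1), schurFin x N mu * schurFin y M mu.transpose =
        ∑ mu ∈ box N M, schurFin x N mu * schurFin y M mu.transpose := by
      symm
      refine Finset.sum_subset (box_mono le_rfl (Nat.le_succ M)) fun mu hmu hmu' => ?_
      rw [schurFin_eq_zero_of_lt y, mul_zero]
      rw [mem_box] at hmu hmu'
      rw [YoungDiagram.colLen_transpose]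
      omega
    rw [h4, ih, ← Finset.prod_mul_distrib]
    refine Finset.prod_congr rfl fun i _ => ?_
    rw [Finset.prod_range_succ]

end FiniteVariables

/-! ### Schur functions in infinitely many variables -/

/-- Multisets in {0, …, N} are sorted by the multiplicity of N, which matches the Cauchy product
with the geometric series of x_N. -/
theorem sum_sym_eq_coeff (x : ℕ → ℂ) (N r : ℕ) :
    ∑ m ∈ (range N).sym r, ((m : Multiset ℕ).map x).prod =
      PowerSeries.coeff r (geomProd x N) := by
  induction N generalizing r with
  | zero =>
    rw [geomProd, Finset.range_zero, Finset.prod_empty, PowerSeries.coeff_one]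
    rcases r with _ | r
    · simp
      rfl
    · simp
  | succ N ih =>
    rw [geomProd, Finset.prod_range_succ, mul_comm, PowerSeries.coeff_mul,
      Finset.Nat.sum_antidiagonal_eq_sum_range_succ (fun i j =>
        PowerSeries.coeff i (PowerSeries.mk fun r => x N ^ r) *
        PowerSeries.coeff j (∏ i ∈ range N, PowerSeries.mk fun r => x i ^ r)),
      ← Fin.sum_univ_eq_sum_range (fun i => PowerSeries.coeff i (PowerSeries.mk fun r => x N ^ r) *
        PowerSeries.coeff (r - i) (∏ i ∈ range N, PowerSeries.mk fun r => x i ^ r))]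
    have h1 : ∀ i : Fin (r + 1), PowerSeries.coeff i (PowerSeries.mk fun r => x N ^ r) *
        PowerSeries.coeff (r - i) (∏ i ∈ range N, PowerSeries.mk fun r => x i ^ r) =
        ∑ m : (range N).sym (r - i), x N ^ (i : ℕ) * ((m.1 : Multiset ℕ).map x).prod := by
      intro i
      rw [PowerSeries.coeff_mk, ← geomProd, ← ih, Finset.mul_sum,
        Finset.sum_coe_sort ((range N).sym (r - i))
          (fun m => x N ^ (i : ℕ) * ((m : Multiset ℕ).map x).prod)]
    simp_rw [h1]
    rw [Finset.range_add_one, ← Finset.sum_coe_sort,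
      ← Fintype.sum_sigma' (fun (i : Fin (r + 1)) (m : (range N).sym (r - i)) =>
        x N ^ (i : ℕ) * ((m.1 : Multiset ℕ).map x).prod)]
    refine (Equiv.sum_comp (Finset.symInsertEquiv (Finset.notMem_range_self)).symm _).symm.trans ?_
    refine Finset.sum_congr rfl fun m _ => ?_
    simp only [Finset.symInsertEquiv_symm_apply_coe, Sym.coe_fill, Sym.coe_replicate,
      Multiset.map_add, Multiset.prod_add, Multiset.map_replicate, Multiset.prod_replicate]
    ring

/-- In the multinomial expansion of (∑ |x_i|)^r every multiset occurs with coefficient at least 1.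
-/
theorem summable_norm_sym {x : ℕ → ℂ} (hx : Summable fun i => ‖x i‖) (r : ℕ) :
    Summable fun m : Sym ℕ r => ‖((m : Multiset ℕ).map x).prod‖ := by
  refine summable_of_sum_le (c := (∑' i, ‖x i‖) ^ r) (fun _ => norm_nonneg _) fun u => ?_
  obtain ⟨N, hN⟩ : ∃ N, u ⊆ (range N).sym r := by
    refine ⟨(u.sup fun m => (m : Multiset ℕ).toFinset).sup id + 1, fun m hm => ?_⟩
    rw [Finset.mem_sym_iff]
    intro a ha
    have h1 : a ∈ u.sup fun m : Sym ℕ r => (m : Multiset ℕ).toFinset := by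
      rw [Finset.mem_sup]
      exact ⟨m, hm, by simpa using ha⟩
    have := Finset.le_sup (f := id) h1
    simp only [id] at this
    simp only [Finset.mem_range]
    omega
  calc ∑ m ∈ u, ‖((m : Multiset ℕ).map x).prod‖
      ≤ ∑ m ∈ (range N).sym r, ‖((m : Multiset ℕ).map x).prod‖ :=
        Finset.sum_le_sum_of_subset_of_nonneg hN fun _ _ _ => norm_nonneg _
    _ ≤ ∑ m ∈ (range N).sym r, (m : Multiset ℕ).countPerms *
          ((m : Multiset ℕ).map fun i => ‖x i‖).prod := by
        refine Finset.sum_le_sum fun m _ => ?_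
        have h1 : ‖((m : Multiset ℕ).map x).prod‖ = ((m : Multiset ℕ).map fun i => ‖x i‖).prod := by
          have := map_multiset_prod (normHom : ℂ →*₀ ℝ) ((m : Multiset ℕ).map x)
          rw [Multiset.map_map] at this
          exact this
        have h2 : (1 : ℝ) ≤ (m : Multiset ℕ).countPerms := by
          rw [Multiset.countPerms, Finsupp.multinomial_eq]
          exact_mod_cast Nat.multinomial_pos _ _
        rw [h1]
        exact le_mul_of_one_le_left (h1 ▸ norm_nonneg _) h2
    _ = (∑ i ∈ range N, ‖x i‖) ^ r := by
        rw [Finset.sum_pow]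
        rfl
    _ ≤ (∑' i, ‖x i‖) ^ r :=
        pow_le_pow_left₀ (Finset.sum_nonneg fun _ _ => norm_nonneg _)
          (hx.sum_le_tsum _ fun _ _ => norm_nonneg _) r

theorem tendsto_coeff_geomProd {x : ℕ → ℂ} (hx : Summable fun i => ‖x i‖) (r : ℕ) :
    Tendsto (fun N => PowerSeries.coeff r (geomProd x N)) atTop (𝓝 (completeAt x r)) := by
  have h1 : Tendsto (fun N => (range N).sym r) atTop atTop := by
    refine tendsto_atTop_finset_of_monotone (fun a b h => Finset.sym_mono (Finset.range_mono h) r)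
      fun m => ⟨(m : Multiset ℕ).toFinset.sup id + 1, ?_⟩
    rw [Finset.mem_sym_iff]
    intro a ha
    have := Finset.le_sup (f := id) (show a ∈ (m : Multiset ℕ).toFinset by simpa using ha)
    simp only [id] at this
    simp only [Finset.mem_range]
    omega
  have h2 := (summable_norm_sym hx r).of_norm.hasSum.comp h1
  refine h2.congr fun N => ?_
  exact sum_sym_eq_coeff x N r

theorem map_schur {A : Type*} [CommRing A] (φ : SymFun →+* A) (lam : YoungDiagram) :
    φ (schur lam) = jacobiTrudi (fun r => φ (complete r)) (lam.colLen 0) lam := by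
  rw [schur, RingHom.map_det]
  rfl

theorem tendsto_schurFin {x : ℕ → ℂ} (hx : Summable fun i => ‖x i‖) (lam : YoungDiagram) :
    Tendsto (fun N => schurFin x N lam) atTop (𝓝 (evalAt x (schur lam))) := by
  have hc : ∀ r : ℤ, Tendsto (fun N => intCoeff (geomProd x N) r) atTop
      (𝓝 (evalAt x (complete r))) := by
    intro r
    rcases r with r | r
    · rcases r with _ | r
      · simpa [complete] using tendsto_const_nhds.congr fun N => (intCoeff_geomProd_zero x N).symm
      · have : evalAt x (complete (Int.ofNat (r + 1))) = completeAt x (r + 1) := by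
          simp [evalAt, complete]
        rw [this]
        exact tendsto_coeff_geomProd hx (r + 1)
    · have : evalAt x (complete (Int.negSucc r)) = 0 := by simp [complete]
      rw [this]
      exact tendsto_const_nhds
  have h := map_schur (evalAt x).toRingHom lam
  simp only [AlgHom.toRingHom_eq_coe, RingHom.coe_coe] at h
  rw [h]
  refine ((Continuous.matrix_det continuous_id).tendsto _).comp ?_
  exact tendsto_pi_nhds.2 fun i => tendsto_pi_nhds.2 fun j => hc _

theorem ofReal_schurFin (x : ℕ → ℝ) (N : ℕ) (lam : YoungDiagram) :
    ((schurFin x N lam : ℝ) : ℂ) = schurFin (fun i => (x i : ℂ)) N lam := by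
  induction N generalizing lam with
  | zero =>
    by_cases h : lam = ⊥
    · rw [h, schurFin_bot, schurFin_bot, Complex.ofReal_one]
    · rw [schurFin_zero _ h, schurFin_zero _ h, Complex.ofReal_zero]
  | succ N ih =>
    classical
    rw [schurFin_succ x N (mem_box_self lam), schurFin_succ _ N (mem_box_self lam)]
    push_cast
    exact Finset.sum_congr rfl fun mu _ => by rw [ih]

theorem schurFin_smul {R : Type*} [CommRing R] (c : R) (x : ℕ → R) (N : ℕ) (lam : YoungDiagram) :
    schurFin (fun i => c * x i) N lam = c ^ lam.card * schurFin x N lam := by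
  induction N generalizing lam with
  | zero =>
    by_cases h : lam = ⊥
    · rw [h, schurFin_bot, schurFin_bot]
      simp [YoungDiagram.card]
    · rw [schurFin_zero _ h, schurFin_zero _ h, mul_zero]
  | succ N ih =>
    classical
    rw [schurFin_succ _ N (mem_box_self lam), schurFin_succ _ N (mem_box_self lam),
      Finset.mul_sum]
    refine Finset.sum_congr rfl fun mu hmu => ?_
    have h1 : mu.card ≤ lam.card :=
      Finset.card_le_card (YoungDiagram.cells_subset_iff.2 (mem_filter.1 hmu).2.1)
    rw [ih, mul_pow, ← pow_sub_mul_pow c h1]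
    ring

/-- Schur functions are homogeneous; with c = -1 this produces the signs (-1)^{|μ|} in the Cauchy
sum. -/
theorem evalAt_smul {x : ℕ → ℂ} (hx : Summable fun i => ‖x i‖) (c : ℂ) (lam : YoungDiagram) :
    evalAt (fun i => c * x i) (schur lam) = c ^ lam.card * evalAt x (schur lam) := by
  have hcx : Summable fun i => ‖c * x i‖ := by
    simpa only [norm_mul] using hx.mul_left ‖c‖
  refine tendsto_nhds_unique (tendsto_schurFin hcx lam) ?_
  simp_rw [schurFin_smul]
  exact (tendsto_schurFin hx lam).const_mul _

/-! ### Absolute bounds and the passage to infinitely many variables -/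

/-- The value of a Schur function at the sequence of absolute values. -/
def absSchur (x : ℕ → ℂ) (lam : YoungDiagram) : ℝ :=
  ‖evalAt (fun i => (‖x i‖ : ℂ)) (schur lam)‖

/-- The norm in `absSchur` only makes the value a real number: the values in finitely many variables
are already nonnegative. -/
theorem tendsto_absSchur {x : ℕ → ℂ} (hx : Summable fun i => ‖x i‖) (lam : YoungDiagram) :
    Tendsto (fun N => schurFin (fun i => ‖x i‖) N lam) atTop (𝓝 (absSchur x lam)) := by
  have h := (tendsto_schurFin (x := fun i => (‖x i‖ : ℂ)) (by simpa using hx) lam).norm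
  refine h.congr fun N => ?_
  rw [← ofReal_schurFin, Complex.norm_real,
    Real.norm_of_nonneg (schurFin_nonneg (fun _ => norm_nonneg _) N lam)]

theorem schurFin_le_absSchur {x : ℕ → ℂ} (hx : Summable fun i => ‖x i‖) (N : ℕ)
    (lam : YoungDiagram) : schurFin (fun i => ‖x i‖) N lam ≤ absSchur x lam :=
  Monotone.ge_of_tendsto (f := fun N => schurFin (fun i => ‖x i‖) N lam)
    (monotone_nat_of_le_succ fun n => schurFin_le_succ (fun _ => norm_nonneg _) n lam)
    (tendsto_absSchur hx lam) N

theorem norm_evalAt_le_absSchur {x : ℕ → ℂ} (hx : Summable fun i => ‖x i‖) (lam : YoungDiagram) :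
    ‖evalAt x (schur lam)‖ ≤ absSchur x lam :=
  le_of_tendsto_of_tendsto' (tendsto_schurFin hx lam).norm (tendsto_absSchur hx lam)
    fun N => norm_schurFin_le x N lam

theorem sum_absSchur_le {x y : ℕ → ℂ} (hx : Summable fun i => ‖x i‖) (hy : Summable fun i => ‖y i‖)
    (hxi : Function.Injective fun i => ‖x i‖) {B : ℝ}
    (hB : ∀ N, ∏ i ∈ range N, ∏ j ∈ range N, (1 + ‖x i‖ * ‖y j‖) ≤ B) (u : Finset YoungDiagram) :
    ∑ mu ∈ u, absSchur x mu * absSchur y mu.transpose ≤ B := by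
  obtain ⟨N₀, hN₀⟩ := exists_subset_box u
  refine le_of_tendsto (tendsto_finsetSum u fun mu _ =>
    (tendsto_absSchur hx mu).mul (tendsto_absSchur hy mu.transpose)) ?_
  filter_upwards [eventually_ge_atTop N₀] with N hN
  refine (Finset.sum_le_sum_of_subset_of_nonneg (hN₀ N hN) fun mu _ _ => ?_).trans
    ((dual_cauchy_fin hxi (fun i => ‖y i‖) N N).trans_le (hB N))
  exact mul_nonneg (schurFin_nonneg (fun _ => norm_nonneg _) N _)
    (schurFin_nonneg (fun _ => norm_nonneg _) N _)

theorem prod_one_add_mul_le {x y : ℕ → ℝ} (hx : Summable x) (hy : Summable y) (hx0 : ∀ i, 0 ≤ x i)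
    (hy0 : ∀ i, 0 ≤ y i) (N : ℕ) :
    ∏ i ∈ range N, ∏ j ∈ range N, (1 + x i * y j) ≤ Real.exp ((∑' i, x i) * ∑' j, y j) := by
  calc ∏ i ∈ range N, ∏ j ∈ range N, (1 + x i * y j)
      ≤ ∏ i ∈ range N, ∏ j ∈ range N, Real.exp (x i * y j) := by
        refine Finset.prod_le_prod (fun i _ => Finset.prod_nonneg fun j _ => ?_) fun i _ =>
          Finset.prod_le_prod (fun j _ => ?_) fun j _ => ?_
        · have := mul_nonneg (hx0 i) (hy0 j); linarith
        · have := mul_nonneg (hx0 i) (hy0 j); linarith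
        · rw [add_comm]; exact Real.add_one_le_exp _
    _ = Real.exp ((∑ i ∈ range N, x i) * ∑ j ∈ range N, y j) := by
        simp_rw [← Real.exp_sum, Finset.sum_mul_sum]
    _ ≤ _ := by
        refine Real.exp_le_exp.2 (mul_le_mul (hx.sum_le_tsum _ fun i _ => hx0 i)
          (hy.sum_le_tsum _ fun i _ => hy0 i) (Finset.sum_nonneg fun i _ => hy0 i)
          (tsum_nonneg hx0))

theorem summable_absSchur {x y : ℕ → ℂ} (hx : Summable fun i => ‖x i‖)
    (hy : Summable fun i => ‖y i‖) (hxi : Function.Injective fun i => ‖x i‖) :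
    Summable fun mu => absSchur x mu * absSchur y mu.transpose :=
  summable_of_sum_le (fun _ => mul_nonneg (norm_nonneg _) (norm_nonneg _))
    (sum_absSchur_le hx hy hxi (prod_one_add_mul_le hx hy (fun _ => norm_nonneg _)
      fun _ => norm_nonneg _))

/-- The dual Cauchy identity in infinitely many variables. -/
theorem dual_cauchy {x y : ℕ → ℂ} (hx : Summable fun i => ‖x i‖)
    (hy : Summable fun i => ‖y i‖) (hxi : Function.Injective fun i => ‖x i‖) :
    Tendsto (fun N => ∏ i ∈ range N, ∏ j ∈ range N, (1 + x i * y j)) atTop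
      (𝓝 (∑' mu : YoungDiagram, evalAt x (schur mu) * evalAt y (schur mu.transpose))) := by
  have hxi' : Function.Injective x := fun a b h => hxi (congrArg norm h)
  have h1 : ∀ N, ∏ i ∈ range N, ∏ j ∈ range N, (1 + x i * y j) =
      ∑' mu : YoungDiagram, schurFin x N mu * schurFin y N mu.transpose := by
    intro N
    rw [← dual_cauchy_fin hxi' y N N, tsum_eq_sum]
    intro mu hmu
    rw [mem_box, not_and_or, rowLen_eq_zero_iff] at hmu
    rcases hmu with h | h
    · rw [schurFin_eq_zero_of_lt x (by omega), zero_mul]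
    · rw [schurFin_eq_zero_of_lt y (by rw [YoungDiagram.colLen_transpose]; omega), mul_zero]
  simp_rw [h1]
  -- Every truncated Schur value is bounded by the full value at the absolute values, and the
  -- products of these are summable by the finite identity itself.
  refine tendsto_tsum_of_dominated_convergence (summable_absSchur hx hy hxi)
    (fun mu => (tendsto_schurFin hx mu).mul (tendsto_schurFin hy mu.transpose))
    (Eventually.of_forall fun N mu => ?_)
  rw [norm_mul]
  exact mul_le_mul ((norm_schurFin_le x N mu).trans (schurFin_le_absSchur hx N mu))
    ((norm_schurFin_le y N _).trans (schurFin_le_absSchur hy N _)) (norm_nonneg _) (norm_nonneg _)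

/-! ### Schur functions as a basis, and the vertex with a trivial leg -/

open Classical in
-- Exponents λ_i + N - 1 - i are strictly decreasing, so in the expansion of the determinant only
-- the identity permutation can give a decreasing exponent vector, and that vector determines λ.
theorem coeff_alternant {N : ℕ} {lam lam0 : YoungDiagram} (hlam : lam.rowLen N = 0)
    (hlam0 : lam0.rowLen N = 0) :
    MvPolynomial.coeff (∑ l : Fin N, Finsupp.single (l : ℕ) (lam0.rowLen l + (N - 1 - l)))
      (alternant (MvPolynomial.X (R := ℚ)) N lam) = if lam = lam0 then 1 else 0 := by
  have key : ∀ σ : Equiv.Perm (Fin N), ∏ l : Fin N, (MvPolynomial.X (R := ℚ) (l : ℕ)) ^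
      (lam.rowLen (σ l) + (N - 1 - σ l)) = MvPolynomial.monomial (∑ l : Fin N,
        Finsupp.single (l : ℕ) (lam.rowLen (σ l) + (N - 1 - σ l))) 1 := by
    intro σ
    rw [MvPolynomial.monomial_sum_one]
    exact Finset.prod_congr rfl fun l _ => MvPolynomial.X_pow_eq_monomial
  have hval : ∀ (k : Fin N → ℕ) (l : Fin N),
      (∑ l : Fin N, Finsupp.single (l : ℕ) (k l)) (l : ℕ) = k l := by
    intro k l
    rw [Finsupp.finsetSum_apply, Finset.sum_eq_single l]
    · simp
    · intro b _ hb
      rw [Finsupp.single_apply, if_neg fun h => hb (Fin.ext h)]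
    · simp
  have hterm : ∀ σ : Equiv.Perm (Fin N), (∀ l : Fin N, lam.rowLen (σ l) + (N - 1 - σ l) =
      lam0.rowLen l + (N - 1 - l)) → σ = 1 ∧ lam = lam0 := by
    intro σ h
    have hmono : StrictMono σ := by
      intro a b hab
      by_contra hc
      have h1 := lam.rowLen_anti (σ b) (σ a) (not_lt.1 hc)
      have h2 := lam0.rowLen_anti a b hab.le
      have h3 := h a
      have h4 := h b
      have h5 : (σ b : ℕ) ≤ σ a := not_lt.1 hc
      have h6 : (a : ℕ) < b := hab
      have := (σ a).2
      have := b.2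
      omega
    have hσ : σ = 1 := by
      have := Subsingleton.elim (hmono.orderIsoOfSurjective σ σ.surjective) (OrderIso.refl (Fin N))
      ext l
      have h7 := congrArg (fun e : Fin N ≃o Fin N => (e l : ℕ)) this
      simpa using h7
    refine ⟨hσ, rowLen_injective (funext fun i => ?_)⟩
    by_cases hi : i < N
    · have := h ⟨i, hi⟩
      rw [hσ] at this
      simpa using this
    · have e1 := lam.rowLen_anti N i (by omega)
      have e2 := lam0.rowLen_anti N i (by omega)
      omega
  rw [alternant, Matrix.det_apply', MvPolynomial.coeff_sum]
  simp only [Matrix.of_apply]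
  have hco : ∀ σ : Equiv.Perm (Fin N), MvPolynomial.coeff
      (∑ l : Fin N, Finsupp.single (l : ℕ) (lam0.rowLen l + (N - 1 - l)))
      ((((Equiv.Perm.sign σ : ℤˣ) : ℤ) : MvPolynomial ℕ ℚ) * ∏ l : Fin N,
        (MvPolynomial.X (R := ℚ) (l : ℕ)) ^ (lam.rowLen (σ l) + (N - 1 - σ l))) =
      if σ = 1 ∧ lam = lam0 then 1 else 0 := by
    intro σ
    rw [key, ← map_intCast (MvPolynomial.C (R := ℚ) (σ := ℕ)), MvPolynomial.coeff_C_mul,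
      MvPolynomial.coeff_monomial]
    by_cases h : σ = 1 ∧ lam = lam0
    · obtain ⟨rfl, rfl⟩ := h
      simp
    · rw [if_neg h, if_neg, mul_zero]
      intro heq
      refine h (hterm σ fun l => ?_)
      have := DFunLike.congr_fun heq (l : ℕ)
      rwa [hval (fun l => lam.rowLen (σ l) + (N - 1 - σ l)),
        hval (fun l => lam0.rowLen l + (N - 1 - l))] at this
  rw [Finset.sum_congr rfl fun σ _ => hco σ]
  by_cases h : lam = lam0
  · simp [h]
  · simp [h]

/-- The specialization of symmetric functions to finitely many variables. -/
theorem exists_specialization (N : ℕ) : ∃ φ : SymFun →ₐ[ℚ] MvPolynomial ℕ ℚ,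
    ∀ lam, φ (schur lam) = schurFin MvPolynomial.X N lam := by
  refine ⟨MvPolynomial.aeval fun r =>
    PowerSeries.coeff (r + 1) (geomProd (MvPolynomial.X (R := ℚ)) N), fun lam => ?_⟩
  have h := map_schur (MvPolynomial.aeval (R := ℚ) fun r =>
    PowerSeries.coeff (r + 1) (geomProd (MvPolynomial.X (R := ℚ)) N)).toRingHom lam
  simp only [AlgHom.toRingHom_eq_coe, RingHom.coe_coe] at h
  rw [h, schurFin]
  congr 1
  funext r
  rcases r with (_ | r) | r
  · simpa [complete] using (intCoeff_geomProd_zero _ N).symm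
  · simp [complete, intCoeff]
  · simp [complete, intCoeff]

/-- A finite relation is specialized to N variables and multiplied by the Vandermonde alternant; the
leading monomials of the resulting alternants separate the diagrams. Independence makes the chosen
expansion in `schurCoeff` the expected one. -/
theorem linearIndependent_schur : LinearIndependent ℚ schur := by
  rw [linearIndependent_iff]
  intro c hc
  obtain ⟨N, hN⟩ := exists_subset_box c.support
  have hN := hN N le_rfl
  obtain ⟨φ, hφ⟩ := exists_specialization N
  have h1 := congrArg (fun f => φ f * alternant (MvPolynomial.X (R := ℚ)) N ⊥) hc
  simp only [Finsupp.linearCombination_apply, Finsupp.sum, map_sum, map_smul, hφ, map_zero,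
    zero_mul, Finset.sum_mul, smul_mul_assoc] at h1
  ext lam0
  by_contra hne
  have hmem : lam0 ∈ c.support := Finsupp.mem_support_iff.2 hne
  have h2 := congrArg (MvPolynomial.coeff
    (∑ l : Fin N, Finsupp.single (l : ℕ) (lam0.rowLen l + (N - 1 - l)))) h1
  rw [MvPolynomial.coeff_sum, MvPolynomial.coeff_zero, Finset.sum_eq_single lam0] at h2
  · rw [MvPolynomial.coeff_smul, ← alternant_eq _ _ (mem_box.1 (hN hmem)).1,
      coeff_alternant (mem_box.1 (hN hmem)).1 (mem_box.1 (hN hmem)).1, if_pos rfl] at h2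
    simp only [smul_eq_mul, mul_one] at h2
    exact hne h2
  · intro lam hlam hneq
    rw [MvPolynomial.coeff_smul, ← alternant_eq _ _ (mem_box.1 (hN hlam)).1,
      coeff_alternant (mem_box.1 (hN hlam)).1 (mem_box.1 (hN hmem)).1, if_neg hneq, smul_zero]
  · exact fun h => absurd hmem h

theorem schurCoeff_schur (nu : YoungDiagram) : schurCoeff (schur nu) = Finsupp.single nu 1 := by
  classical
  have h : ∃ c : YoungDiagram →₀ ℚ, schur nu = c.sum fun lam a => a • schur lam :=
    ⟨Finsupp.single nu 1, by simp⟩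
  rw [schurCoeff, dif_pos h]
  apply linearIndependent_schur.finsuppLinearCombination_injective
  have := h.choose_spec
  rw [Finsupp.linearCombination_apply, ← this]
  simp

theorem constantCoeff_schur {lam : YoungDiagram} (h : lam ≠ ⊥) :
    MvPolynomial.constantCoeff (schur lam) = 0 := by
  rw [map_schur]
  refine jacobiTrudi_eq_zero (fun r hr => ?_) h
  rcases r with (_ | r) | r
  · simp at hr
  · simp [complete]
  · simp [complete]

theorem schur_bot : schur ⊥ = 1 := by
  rw [schur, Matrix.det_eq_one_of_card_eq_zero]
  simp [colLen_bot]

/-- Among Schur functions only s_∅ = 1 has a constant term, so it reads off the coefficient of s_∅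
in any expansion. If no expansion existed, the default value would be 0 as well, so spanning need
not be proved. -/
theorem schurCoeff_bot_eq_zero {f : SymFun} (hf : MvPolynomial.constantCoeff f = 0) :
    schurCoeff f ⊥ = 0 := by
  classical
  rw [schurCoeff]
  split_ifs with h
  · have h1 := congrArg MvPolynomial.constantCoeff h.choose_spec
    rw [hf, Finsupp.sum, map_sum, Finset.sum_eq_single ⊥] at h1
    · rw [MvPolynomial.constantCoeff_smul, schur_bot] at h1
      simpa using h1.symm
    · intro lam _ hlam
      rw [MvPolynomial.constantCoeff_smul, constantCoeff_schur hlam, smul_zero]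
    · intro hb
      rw [Finsupp.notMem_support_iff.1 hb, zero_smul, map_zero]
  · rfl

theorem skewSchur_bot_right (mu : YoungDiagram) : skewSchur mu ⊥ = schur mu := by
  classical
  rw [skewSchur, finsum_eq_single _ mu]
  · rw [lrCoeff, schur_bot, one_mul, schurCoeff_schur, Finsupp.single_eq_same, one_smul]
  · intro nu hnu
    rw [lrCoeff, schur_bot, one_mul, schurCoeff_schur, Finsupp.single_eq_of_ne hnu.symm, zero_smul]

theorem skewSchur_bot_left {eta : YoungDiagram} (h : eta ≠ ⊥) : skewSchur ⊥ eta = 0 := by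
  rw [skewSchur]
  refine (finsum_congr fun nu => ?_).trans finsum_zero
  rw [lrCoeff, schurCoeff_bot_eq_zero, zero_smul]
  rw [map_mul, constantCoeff_schur h, zero_mul]

/-! ### The vertex with an empty first leg -/

theorem kappa_bot : kappa ⊥ = 0 := by simp [kappa, colLen_bot]

/-- For η ≠ ∅ the factor s_{∅/η} vanishes. -/
theorem vertex_bot_left (w : ℂ) (mu nu : YoungDiagram) :
    vertex w ⊥ mu nu = w ^ kappa nu * evalAt (shiftPow w ⊥) (schur nu.transpose) *
      evalAt (shiftPow w nu.transpose) (schur mu) := by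
  rw [vertex, kappa_bot, zero_add, finsum_eq_single _ ⊥, transpose_bot, skewSchur_bot_right,
    skewSchur_bot_right, schur_bot, map_one, one_mul]
  intro eta h
  rw [transpose_bot, skewSchur_bot_left h, map_zero, zero_mul]

theorem kappa_eq_sum_cells (lam : YoungDiagram) :
    kappa lam = ∑ c ∈ lam.cells, (2 * (c.2 : ℤ) - 2 * (c.1 : ℤ)) := by
  rw [kappa, sum_cells lam (rowLen_eq_zero_iff.2 le_rfl) fun i j => 2 * (j : ℤ) - 2 * (i : ℤ)]
  refine Finset.sum_congr rfl fun i _ => ?_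
  induction lam.rowLen i with
  | zero => simp
  | succ m ih =>
    rw [Finset.sum_range_succ, ← ih]
    push_cast
    ring

/-- κ is twice the sum of the contents j - i, and conjugation changes their sign. -/
theorem kappa_transpose (lam : YoungDiagram) : kappa lam.transpose = -kappa lam := by
  rw [kappa_eq_sum_cells, kappa_eq_sum_cells,
    sum_cells_transpose lam fun i j => 2 * (j : ℤ) - 2 * (i : ℤ), ← Finset.sum_neg_distrib]
  exact Finset.sum_congr rfl fun c _ => by ring

theorem zTerm_one_eq {w : ℂ} (hw : w ≠ 0) (Q : ℂ) (mu nu : YoungDiagram) :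
    zTerm Q 1 w (mu, nu) = (-Q) ^ nu.card * (evalAt (shiftPow w ⊥) (schur nu) *
      evalAt (shiftPow w ⊥) (schur nu.transpose)) * ((-1) ^ mu.card *
        (evalAt (shiftPow w nu) (schur mu) *
          evalAt (shiftPow w nu.transpose) (schur mu.transpose))) := by
  simp only [zTerm, vertex_bot_left, YoungDiagram.transpose_transpose, kappa_transpose]
  have h : w ^ kappa nu * w ^ (-kappa nu) = 1 := by
    rw [← zpow_add₀ hw, add_neg_cancel, zpow_zero]
  linear_combination ((-Q) ^ nu.card * (evalAt (shiftPow w ⊥) (schur nu) *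
      evalAt (shiftPow w ⊥) (schur nu.transpose)) * ((-1) ^ mu.card *
        (evalAt (shiftPow w nu) (schur mu) *
          evalAt (shiftPow w nu.transpose) (schur mu.transpose)))) * h

/-! ### Principal specializations -/

/-- The difference of the content-like coordinates of row `i` and column `j`; on the cells of `nu`
it is the hook length, and outside it is negative. -/
def hook (nu : YoungDiagram) (i j : ℕ) : ℤ :=
  (nu.rowLen i : ℤ) + nu.colLen j - i - j - 1

theorem hook_pos {nu : YoungDiagram} {i j : ℕ} (h : (i, j) ∈ nu) : 0 < hook nu i j := by
  have h1 := YoungDiagram.mem_iff_lt_rowLen.1 h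
  have h2 := YoungDiagram.mem_iff_lt_colLen.1 h
  rw [hook]
  omega

theorem hook_neg {nu : YoungDiagram} {i j : ℕ} (h : (i, j) ∉ nu) : hook nu i j < 0 := by
  have h1 : ¬ j < nu.rowLen i := fun h' => h (YoungDiagram.mem_iff_lt_rowLen.2 h')
  have h2 : ¬ i < nu.colLen j := fun h' => h (YoungDiagram.mem_iff_lt_colLen.2 h')
  rw [hook]
  omega

theorem hook_ne_zero (nu : YoungDiagram) (i j : ℕ) : hook nu i j ≠ 0 := by
  by_cases h : (i, j) ∈ nu
  · exact (hook_pos h).ne'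
  · exact (hook_neg h).ne

theorem hook_bot (i j : ℕ) : hook ⊥ i j = -((i : ℤ) + j + 1) := by
  rw [hook, rowLen_bot, colLen_bot]
  push_cast
  ring

/-- A row of length m contributes m² = 1 + 3 + ⋯ + (2m - 1) to the sum of row lengths over cells,
and columns behave likewise. The identity makes the monomials in w cancel in the product formula. -/
theorem sum_hook (nu : YoungDiagram) :
    ∑ c ∈ nu.cells, 2 * hook nu c.1 c.2 =
      ∑ c ∈ nu.cells, (2 * (c.1 : ℤ) + 1) + ∑ c ∈ nu.cells, (2 * (c.2 : ℤ) + 1) := by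
  have row : ∀ lam : YoungDiagram, ∑ c ∈ lam.cells, 2 * (lam.rowLen c.1 : ℤ) =
      ∑ c ∈ lam.cells, 2 * (2 * (c.2 : ℤ) + 1) := by
    intro lam
    rw [sum_cells lam (rowLen_eq_zero_iff.2 le_rfl) fun i _ => 2 * (lam.rowLen i : ℤ),
      sum_cells lam (rowLen_eq_zero_iff.2 le_rfl) fun _ j => 2 * (2 * (j : ℤ) + 1)]
    refine Finset.sum_congr rfl fun i _ => ?_
    rw [Finset.sum_const, Finset.card_range]
    induction lam.rowLen i with
    | zero => simp
    | succ m ih =>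
      rw [Finset.sum_range_succ, ← ih]
      simp only [nsmul_eq_mul]
      push_cast
      ring
  have h1 := row nu
  have h2 := row nu.transpose
  rw [sum_cells_transpose nu fun i _ => 2 * (nu.transpose.rowLen i : ℤ),
    sum_cells_transpose nu fun _ j => 2 * (2 * (j : ℤ) + 1)] at h2
  simp only [YoungDiagram.rowLen_transpose] at h2
  calc ∑ c ∈ nu.cells, 2 * hook nu c.1 c.2
      = ∑ c ∈ nu.cells, 2 * (nu.rowLen c.1 : ℤ) + ∑ c ∈ nu.cells, 2 * (nu.colLen c.2 : ℤ) -
        ∑ c ∈ nu.cells, 2 * ((c.1 : ℤ) + c.2 + 1) := by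
        rw [← Finset.sum_add_distrib, ← Finset.sum_sub_distrib]
        exact Finset.sum_congr rfl fun c _ => by rw [hook]; ring
    _ = _ := by
        rw [h1, h2, ← Finset.sum_add_distrib, ← Finset.sum_sub_distrib, ← Finset.sum_add_distrib]
        exact Finset.sum_congr rfl fun c _ => by ring

/-! ### Particles and holes -/

/-- The positions of the particles (rows) and holes (columns) of a diagram. -/
def position (nu : YoungDiagram) (N : ℕ) : Fin N ⊕ Fin N → ℤ :=
  Sum.elim (fun i => (nu.rowLen i : ℤ) - i) fun j => (j : ℤ) + 1 - nu.colLen j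

/-- A row and a column never share a position, since the difference is a value of `hook`, which is
nonzero everywhere. -/
theorem position_injective (nu : YoungDiagram) (N : ℕ) : Function.Injective (position nu N) := by
  have hc : ∀ i j : Fin N, (nu.rowLen i : ℤ) - i ≠ (j : ℤ) + 1 - nu.colLen j := by
    intro i j h
    refine hook_ne_zero nu i j ?_
    rw [hook]
    omega
  rintro (i | i) (j | j) h
  · simp only [position, Sum.elim_inl] at h
    congr 1
    refine Fin.ext ?_
    rcases le_total (i : ℕ) j with hij | hij
    · have := nu.rowLen_anti i j hij
      omega
    · have := nu.rowLen_anti j i hij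
      omega
  · exact absurd h (hc i j)
  · exact absurd h.symm (hc j i)
  · simp only [position, Sum.elim_inr] at h
    congr 1
    refine Fin.ext ?_
    rcases le_total (i : ℕ) j with hij | hij
    · have := nu.colLen_anti i j hij
      omega
    · have := nu.colLen_anti j i hij
      omega

/-- There are 2N distinct positions in an interval of 2N integers, so they fill it. -/
theorem image_position {nu : YoungDiagram} {N : ℕ} (h : nu ∈ box N N) :
    univ.image (position nu N) = Icc (1 - (N : ℤ)) N := by
  have h' := transpose_mem_box.2 h
  rw [mem_box] at h h'
  rw [YoungDiagram.rowLen_transpose, YoungDiagram.rowLen_transpose] at h'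
  refine Finset.eq_of_subset_of_card_le ?_ ?_
  · intro z hz
    rw [Finset.mem_image] at hz
    obtain ⟨p, -, rfl⟩ := hz
    rw [Finset.mem_Icc]
    rcases p with i | j
    · have := nu.rowLen_anti 0 i (Nat.zero_le _)
      have := i.2
      simp only [position, Sum.elim_inl]
      omega
    · have := nu.colLen_anti 0 j (Nat.zero_le _)
      have := j.2
      simp only [position, Sum.elim_inr]
      omega
  · rw [Finset.card_image_of_injective _ (position_injective nu N), Finset.card_univ,
      Fintype.card_sum, Fintype.card_fin, Int.card_Icc]
    omega

theorem prod_position {R : Type*} [CommMonoid R] {nu : YoungDiagram} {N : ℕ} (h : nu ∈ box N N)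
    (F : ℤ → ℤ → R) : ∏ p, ∏ p', F (position nu N p) (position nu N p') =
      ∏ a ∈ Icc (1 - (N : ℤ)) N, ∏ b ∈ Icc (1 - (N : ℤ)) N, F a b := by
  rw [← image_position h, Finset.prod_image (position_injective nu N).injOn]
  refine Finset.prod_congr rfl fun p _ => ?_
  rw [Finset.prod_image (position_injective nu N).injOn]

/-- The factor attached to a pair of positions. -/
def pairFactor (w : ℂ) (d : ℤ) : ℂ := if 0 < d then 1 - w ^ (-(2 * d)) else 1

theorem zpow_ne_one {w : ℂ} (hw : 1 < ‖w‖) {d : ℤ} (hd : d ≠ 0) : w ^ d ≠ 1 := by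
  intro h
  have h1 := congrArg norm h
  rw [norm_zpow, norm_one, zpow_eq_one_iff_right₀ (norm_nonneg _) hw.ne'] at h1
  exact hd h1

theorem pairFactor_ne_zero {w : ℂ} (hw : 1 < ‖w‖) (d : ℤ) : pairFactor w d ≠ 0 := by
  rw [pairFactor]
  split_ifs with h
  · exact sub_ne_zero.2 (zpow_ne_one hw (by omega)).symm
  · exact one_ne_zero

/-- The product of the factors of all pairs of rows of a diagram. -/
def rowProd (w : ℂ) (N : ℕ) (nu : YoungDiagram) : ℂ :=
  ∏ i : Fin N, ∏ i' : Fin N,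
    pairFactor w (((nu.rowLen i : ℤ) - i) - ((nu.rowLen i' : ℤ) - i'))

theorem rowProd_ne_zero {w : ℂ} (hw : 1 < ‖w‖) (N : ℕ) (nu : YoungDiagram) :
    rowProd w N nu ≠ 0 :=
  Finset.prod_ne_zero_iff.2 fun _ _ => Finset.prod_ne_zero_iff.2 fun _ _ => pairFactor_ne_zero hw _

theorem shiftPow_bot (w : ℂ) (i : ℕ) : shiftPow w ⊥ i = w ^ (-(2 * (i : ℤ) + 1)) := by
  rw [shiftPow, rowLen_bot]
  congr 1

/-- With a_i = ν_i + N - 1 - i and x_l = w^{-(2l+1)}, the entry x_l^{a_i} is w^{-a_i} (w^{-2a_i})^l,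
so the alternant is a Vandermonde determinant in the numbers w^{-2a_i}. -/
theorem alternant_shiftPow {w : ℂ} (hw : 1 < ‖w‖) (N : ℕ) (nu : YoungDiagram) :
    alternant (shiftPow w ⊥) N nu =
      w ^ (-∑ i : Fin N, (2 * (i : ℤ) + 1) * ((nu.rowLen i + (N - 1 - i) : ℕ) : ℤ)) *
        rowProd w N nu := by
  have hw0 : w ≠ 0 := by rintro rfl; simp at hw; linarith
  set al : Fin N → ℕ := fun i => nu.rowLen i + (N - 1 - i) with hal
  have h1 : alternant (shiftPow w ⊥) N nu = (∏ i, w ^ (-(al i : ℤ))) *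
      (Matrix.vandermonde fun i => w ^ (-(2 * (al i : ℤ)))).det := by
    rw [← Matrix.det_mul_column, alternant]
    congr 1
    ext i l
    simp only [Matrix.of_apply, Matrix.vandermonde_apply, shiftPow_bot]
    rw [← zpow_natCast, ← zpow_natCast, ← zpow_mul, ← zpow_mul, ← zpow_add₀ hw0]
    congr 1
    simp only [hal]
    ring
  have h2 : ∀ i i' : Fin N, i < i' → w ^ (-(2 * (al i' : ℤ))) - w ^ (-(2 * (al i : ℤ))) =
      w ^ (-(2 * (al i' : ℤ))) *
        pairFactor w (((nu.rowLen i : ℤ) - i) - ((nu.rowLen i' : ℤ) - i')) := by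
    intro i i' h
    have h3 := nu.rowLen_anti i i' h.le
    have h4 : (i : ℕ) < i' := h
    have h5 := i'.2
    rw [pairFactor, if_pos (by omega), mul_sub, mul_one, ← zpow_add₀ hw0]
    congr 2
    simp only [hal]
    omega
  rw [h1, Matrix.det_vandermonde, Finset.prod_congr rfl fun i _ =>
    Finset.prod_congr rfl fun i' hi' => h2 i i' (Finset.mem_Ioi.1 hi')]
  simp_rw [Finset.prod_mul_distrib]
  have h6 : ∏ i : Fin N, ∏ i' ∈ Ioi i, w ^ (-(2 * (al i' : ℤ))) =
      ∏ i' : Fin N, w ^ (-(2 * (i' : ℤ) * (al i' : ℤ))) := by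
    rw [Finset.prod_comm' (t' := univ) (s' := fun i' => Iio i') (by simp)]
    refine Finset.prod_congr rfl fun i' _ => ?_
    rw [Finset.prod_const, Fin.card_Iio, ← zpow_natCast, ← zpow_mul]
    congr 1
    ring
  -- For i' ≤ i the difference of positions is not positive, so `pairFactor` is 1 by its default
  -- branch.
  have h7 : ∏ i : Fin N, ∏ i' ∈ Ioi i,
      pairFactor w (((nu.rowLen i : ℤ) - i) - ((nu.rowLen i' : ℤ) - i')) = rowProd w N nu := by
    refine Finset.prod_congr rfl fun i _ => ?_
    refine Finset.prod_subset (Finset.subset_univ _) fun i' _ hi' => ?_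
    have h8 : i' ≤ i := not_lt.1 fun h => hi' (Finset.mem_Ioi.2 h)
    have h9 : (i' : ℕ) ≤ i := h8
    have h3 := nu.rowLen_anti i' i h9
    rw [pairFactor, if_neg (by omega)]
  have h10 : ∀ s : Fin N → ℤ, ∏ i, w ^ s i = w ^ ∑ i, s i := by
    intro s
    induction (univ : Finset (Fin N)) using Finset.induction_on with
    | empty => simp
    | insert a t ha ih => rw [Finset.prod_insert ha, Finset.sum_insert ha, ih, zpow_add₀ hw0]
  rw [h6, h7, ← mul_assoc, ← Finset.prod_mul_distrib]
  congr 1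
  rw [← Finset.sum_neg_distrib, ← h10]
  refine Finset.prod_congr rfl fun i _ => ?_
  rw [← zpow_add₀ hw0]
  congr 1
  ring

theorem schurFin_shiftPow {w : ℂ} (hw : 1 < ‖w‖) {N : ℕ} {nu : YoungDiagram}
    (h : nu.rowLen N = 0) :
    schurFin (shiftPow w ⊥) N nu * rowProd w N ⊥ =
      w ^ (-∑ c ∈ nu.cells, (2 * (c.1 : ℤ) + 1)) * rowProd w N nu := by
  have hw0 : w ≠ 0 := by rintro rfl; simp at hw; linarith
  have h1 := alternant_eq (shiftPow w ⊥) N h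
  rw [alternant_shiftPow hw, alternant_shiftPow hw] at h1
  have h2 : ∑ c ∈ nu.cells, (2 * (c.1 : ℤ) + 1) =
      ∑ i : Fin N, (2 * (i : ℤ) + 1) * ((nu.rowLen i : ℕ) : ℤ) := by
    rw [sum_cells nu h fun i _ => 2 * (i : ℤ) + 1,
      Fin.sum_univ_eq_sum_range (fun i => (2 * (i : ℤ) + 1) * (nu.rowLen i : ℤ))]
    refine Finset.sum_congr rfl fun i _ => ?_
    rw [Finset.sum_const, Finset.card_range, nsmul_eq_mul, mul_comm]
  have h3 : -∑ i : Fin N, (2 * (i : ℤ) + 1) * ((nu.rowLen i + (N - 1 - i) : ℕ) : ℤ) =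
      -∑ c ∈ nu.cells, (2 * (c.1 : ℤ) + 1) +
      -∑ i : Fin N, (2 * (i : ℤ) + 1) * (((⊥ : YoungDiagram).rowLen i + (N - 1 - i) : ℕ) : ℤ) := by
    rw [h2, ← neg_add, ← Finset.sum_add_distrib]
    congr 1
    refine Finset.sum_congr rfl fun i _ => ?_
    rw [rowLen_bot]
    push_cast
    ring
  rw [h3, zpow_add₀ hw0] at h1
  have h4 := zpow_ne_zero (-∑ i : Fin N, (2 * (i : ℤ) + 1) *
    (((⊥ : YoungDiagram).rowLen i + (N - 1 - i) : ℕ) : ℤ)) hw0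
  refine mul_left_cancel₀ h4 ?_
  linear_combination -h1

/-- The product of the factors of all pairs of a row and a column. -/
def crossProd (w : ℂ) (N : ℕ) (nu : YoungDiagram) : ℂ :=
  ∏ i ∈ range N, ∏ j ∈ range N, (1 - w ^ (-(2 * |hook nu i j|)))

theorem rowProd_mul_crossProd (w : ℂ) {N : ℕ} {nu : YoungDiagram} (h : nu ∈ box N N) :
    rowProd w N nu * rowProd w N nu.transpose * crossProd w N nu =
      ∏ a ∈ Icc (1 - (N : ℤ)) N, ∏ b ∈ Icc (1 - (N : ℤ)) N, pairFactor w (a - b) := by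
  rw [← prod_position h fun a b => pairFactor w (a - b), Fintype.prod_sum_type]
  simp_rw [Fintype.prod_sum_type, Finset.prod_mul_distrib]
  have h1 : ∏ j : Fin N, ∏ j' : Fin N, pairFactor w (position nu N (Sum.inr j) -
      position nu N (Sum.inr j')) = rowProd w N nu.transpose := by
    rw [rowProd, Finset.prod_comm]
    refine Finset.prod_congr rfl fun j _ => Finset.prod_congr rfl fun j' _ => ?_
    simp only [position, Sum.elim_inr, YoungDiagram.rowLen_transpose]
    congr 1
    ring
  -- Of the two orders of a row and a column exactly one has a positive difference, and it
  -- contributes 1 - w^{-2|h|}.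
  have h2 : (∏ i : Fin N, ∏ j : Fin N, pairFactor w (position nu N (Sum.inl i) -
      position nu N (Sum.inr j))) * (∏ j : Fin N, ∏ i : Fin N,
        pairFactor w (position nu N (Sum.inr j) - position nu N (Sum.inl i))) =
      crossProd w N nu := by
    rw [Finset.prod_comm (s := (univ : Finset (Fin N))) (t := (univ : Finset (Fin N)))
      (f := fun j i => pairFactor w (position nu N (Sum.inr j) - position nu N (Sum.inl i))),
      ← Finset.prod_mul_distrib, crossProd,
      ← Fin.prod_univ_eq_prod_range (fun i => ∏ j ∈ range N, (1 - w ^ (-(2 * |hook nu i j|))))]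
    refine Finset.prod_congr rfl fun i _ => ?_
    rw [← Finset.prod_mul_distrib,
      ← Fin.prod_univ_eq_prod_range (fun j => (1 - w ^ (-(2 * |hook nu i j|))))]
    refine Finset.prod_congr rfl fun j _ => ?_
    have e1 : position nu N (Sum.inl i) - position nu N (Sum.inr j) = hook nu i j := by
      simp only [position, Sum.elim_inl, Sum.elim_inr, hook]
      ring
    rw [← neg_sub (position nu N (Sum.inl i)), e1, pairFactor, pairFactor]
    rcases lt_or_gt_of_ne (hook_ne_zero nu i j) with h | h
    · rw [if_neg (by omega), if_pos (by omega), abs_of_neg h, one_mul]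
    · rw [if_pos h, if_neg (by omega), abs_of_pos h, mul_one]
  rw [h1, ← h2]
  simp only [rowProd, position, Sum.elim_inl]
  ring

theorem shiftPow_mul_shiftPow {w : ℂ} (hw : w ≠ 0) (nu : YoungDiagram) (i j : ℕ) :
    shiftPow w nu i * shiftPow w nu.transpose j = w ^ (2 * hook nu i j) := by
  rw [shiftPow, shiftPow, ← zpow_add₀ hw, YoungDiagram.rowLen_transpose, hook]
  congr 1
  ring

theorem prod_one_sub_shiftPow {w : ℂ} (hw : w ≠ 0) {N : ℕ} {nu : YoungDiagram}
    (h : nu ∈ box N N) :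
    ∏ i ∈ range N, ∏ j ∈ range N, (1 - shiftPow w nu i * shiftPow w nu.transpose j) =
      (-1) ^ nu.card * w ^ (∑ c ∈ nu.cells, 2 * hook nu c.1 c.2) * crossProd w N nu := by
  -- On a cell h > 0 and 1 - w^{2h} = -w^{2h} (1 - w^{-2h}); outside the diagram 2h is already
  -- -2|h|.
  have h1 : ∀ i j, 1 - shiftPow w nu i * shiftPow w nu.transpose j =
      (if (i, j) ∈ nu.cells then -w ^ (2 * hook nu i j) else 1) *
        (1 - w ^ (-(2 * |hook nu i j|))) := by
    intro i j
    rw [shiftPow_mul_shiftPow hw]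
    split_ifs with hij
    · rw [abs_of_pos (hook_pos ((nu.mem_cells _).1 hij)), neg_mul, mul_sub, mul_one,
        ← zpow_add₀ hw, add_neg_cancel, zpow_zero]
      ring
    · rw [abs_of_neg (hook_neg fun h' => hij ((nu.mem_cells _).2 h')), one_mul]
      congr 2
      ring
  have h2 : nu.cells ⊆ range N ×ˢ range N := by
    simpa [box] using h
  have h10 : ∏ c ∈ nu.cells, w ^ (2 * hook nu c.1 c.2) =
      w ^ ∑ c ∈ nu.cells, 2 * hook nu c.1 c.2 := by
    induction nu.cells using Finset.induction_on with
    | empty => simp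
    | insert a t ha ih => rw [Finset.prod_insert ha, Finset.sum_insert ha, ih, zpow_add₀ hw]
  simp_rw [h1, Finset.prod_mul_distrib]
  rw [← crossProd, ← Finset.prod_product' (range N) (range N)
    (fun i j => if (i, j) ∈ nu.cells then -w ^ (2 * hook nu i j) else 1),
    ← Finset.prod_subset h2]
  · rw [Finset.prod_congr rfl fun c hc => if_pos (show (c.1, c.2) ∈ nu.cells from hc),
      Finset.prod_neg, h10]
  · intro c _ hc
    exact if_neg hc

/-- The product formula for principal specializations of conjugate Schur polynomials. -/
theorem schurFin_mul_schurFin_mul_prod {w : ℂ} (hw : 1 < ‖w‖) {N : ℕ} {nu : YoungDiagram}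
    (h : nu ∈ box N N) :
    schurFin (shiftPow w ⊥) N nu * schurFin (shiftPow w ⊥) N nu.transpose *
      ∏ i ∈ range N, ∏ j ∈ range N, (1 - shiftPow w nu i * shiftPow w nu.transpose j) =
      (-1) ^ nu.card *
        ∏ i ∈ range N, ∏ j ∈ range N, (1 - shiftPow w ⊥ i * shiftPow w ⊥ j) := by
  have hw0 : w ≠ 0 := by rintro rfl; simp at hw; linarith
  have hb : ∏ i ∈ range N, ∏ j ∈ range N, (1 - shiftPow w ⊥ i * shiftPow w ⊥ j) =
      crossProd w N ⊥ := by
    have := prod_one_sub_shiftPow hw0 (bot_mem_box N N)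
    rw [transpose_bot] at this
    rw [this]
    simp [YoungDiagram.card]
  have h1 := schurFin_shiftPow hw (mem_box.1 h).1
  have h2 := schurFin_shiftPow hw (mem_box.1 (transpose_mem_box.2 h)).1
  rw [sum_cells_transpose nu fun i _ => 2 * (i : ℤ) + 1] at h2
  have h3 := (rowProd_mul_crossProd w h).trans (rowProd_mul_crossProd w (bot_mem_box N N)).symm
  rw [transpose_bot] at h3
  have h4 : w ^ (-∑ c ∈ nu.cells, (2 * (c.1 : ℤ) + 1)) *
      w ^ (-∑ c ∈ nu.cells, (2 * (c.2 : ℤ) + 1)) *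
      w ^ (∑ c ∈ nu.cells, 2 * hook nu c.1 c.2) = 1 := by
    rw [← zpow_add₀ hw0, ← zpow_add₀ hw0, sum_hook, ← neg_add, neg_add_cancel, zpow_zero]
  rw [hb, prod_one_sub_shiftPow hw0 h]
  refine mul_right_cancel₀ (mul_ne_zero (rowProd_ne_zero hw N ⊥) (rowProd_ne_zero hw N ⊥)) ?_
  calc _ = (schurFin (shiftPow w ⊥) N nu * rowProd w N ⊥) *
        (schurFin (shiftPow w ⊥) N nu.transpose * rowProd w N ⊥) *
        ((-1) ^ nu.card * w ^ (∑ c ∈ nu.cells, 2 * hook nu c.1 c.2) * crossProd w N nu) := by ring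
    _ = (-1) ^ nu.card * (rowProd w N nu * rowProd w N nu.transpose * crossProd w N nu) *
        (w ^ (-∑ c ∈ nu.cells, (2 * (c.1 : ℤ) + 1)) *
          w ^ (-∑ c ∈ nu.cells, (2 * (c.2 : ℤ) + 1)) *
          w ^ (∑ c ∈ nu.cells, 2 * hook nu c.1 c.2)) := by rw [h1, h2]; ring
    _ = _ := by rw [h3, h4]; ring

/-! ### Sums over partitions -/

/-- The diagram without its first row. -/
def tail (nu : YoungDiagram) : YoungDiagram :=
  ofAntitone (nu.colLen 0) (fun i => nu.rowLen (i + 1))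
    fun _ _ h => nu.rowLen_anti _ _ (Nat.succ_le_succ h)

theorem rowLen_tail (nu : YoungDiagram) (i : ℕ) : (tail nu).rowLen i = nu.rowLen (i + 1) :=
  rowLen_ofAntitone (N := nu.colLen 0) (f := fun i => nu.rowLen (i + 1))
    (fun _ _ h => nu.rowLen_anti _ _ (Nat.succ_le_succ h))
    (rowLen_eq_zero_iff.2 (Nat.le_succ _)) i

theorem card_eq_tail (nu : YoungDiagram) : nu.card = nu.rowLen 0 + (tail nu).card := by
  have h1 : nu.rowLen (nu.colLen 0 + 1) = 0 := rowLen_eq_zero_iff.2 (Nat.le_succ _)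
  rw [card_eq_sum nu h1, Finset.sum_range_succ',
    card_eq_sum (tail nu) (N := nu.colLen 0) (by rw [rowLen_tail, h1]), add_comm]
  simp_rw [rowLen_tail]

theorem tail_injOn (m : ℕ) : Set.InjOn tail {nu | nu.rowLen 0 = m} := by
  intro nu hnu nu' hnu' h
  refine rowLen_injective (funext fun i => ?_)
  rcases i with _ | i
  · exact Eq.trans hnu (Eq.symm hnu')
  · rw [← rowLen_tail, h, rowLen_tail]

theorem exists_tail_eq {m : ℕ} {mu : YoungDiagram} (h : mu.rowLen 0 ≤ m) :
    ∃ nu : YoungDiagram, nu.rowLen 0 = m ∧ tail nu = mu := by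
  have hanti : Antitone fun i : ℕ => if i = 0 then m else mu.rowLen (i - 1) := by
    refine antitone_nat_of_succ_le fun i => ?_
    rcases i with _ | i
    · simpa using h
    · simpa using mu.rowLen_anti i (i + 1) (Nat.le_succ i)
  have hrow := rowLen_ofAntitone (N := mu.colLen 0 + 1) hanti
    (by simpa using rowLen_eq_zero_iff.2 le_rfl)
  refine ⟨ofAntitone _ _ hanti, by rw [hrow]; simp, rowLen_injective (funext fun i => ?_)⟩
  rw [rowLen_tail, hrow]
  simp

/-- Diagrams with first row N + 1 inject, by deleting that row, into the same box. So the sum A over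
the larger box satisfies A ≤ B + r^{N+1} A, with B the sum over the smaller one. -/
theorem sum_box_le {r : ℝ} (h0 : 0 ≤ r) (h1 : r < 1) (L N : ℕ) :
    ∑ nu ∈ box L N, r ^ nu.card ≤ ∏ k ∈ range N, (1 - r ^ (k + 1))⁻¹ := by
  classical
  induction N with
  | zero =>
    have : ∀ nu ∈ box L 0, nu = ⊥ := by
      intro nu h
      rw [mem_box, Nat.le_zero] at h
      refine rowLen_injective (funext fun i => ?_)
      have := nu.rowLen_anti 0 i (Nat.zero_le i)
      rw [rowLen_bot]
      omega
    refine (Finset.sum_le_sum_of_subset_of_nonneg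
      (fun nu h => Finset.mem_singleton.2 (this nu h)) fun _ _ _ => pow_nonneg h0 _).trans ?_
    simp [YoungDiagram.card]
  | succ N ih =>
    have hr : 0 < 1 - r ^ (N + 1) := sub_pos.2 (pow_lt_one₀ h0 h1 (Nat.succ_ne_zero N))
    have hsub : (box L (N + 1)).filter (fun nu => ¬ nu.rowLen 0 = N + 1) ⊆ box L N := by
      intro nu h
      rw [mem_filter, mem_box] at h
      exact mem_box.2 ⟨h.1.1, by omega⟩
    have h2 : ∑ nu ∈ (box L (N + 1)).filter (fun nu => nu.rowLen 0 = N + 1), r ^ nu.card ≤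
        r ^ (N + 1) * ∑ nu ∈ box L (N + 1), r ^ nu.card := by
      rw [Finset.mul_sum]
      calc ∑ nu ∈ (box L (N + 1)).filter (fun nu => nu.rowLen 0 = N + 1), r ^ nu.card
          = ∑ nu ∈ (box L (N + 1)).filter (fun nu => nu.rowLen 0 = N + 1),
              r ^ (N + 1) * r ^ (tail nu).card := by
            refine Finset.sum_congr rfl fun nu hnu => ?_
            rw [card_eq_tail, (mem_filter.1 hnu).2, pow_add]
        _ = ∑ mu ∈ ((box L (N + 1)).filter (fun nu => nu.rowLen 0 = N + 1)).image tail,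
              r ^ (N + 1) * r ^ mu.card := by
            rw [Finset.sum_image]
            exact fun a ha b hb h => tail_injOn (N + 1) (mem_filter.1 ha).2 (mem_filter.1 hb).2 h
        _ ≤ _ := by
            refine Finset.sum_le_sum_of_subset_of_nonneg ?_ fun _ _ _ =>
              mul_nonneg (pow_nonneg h0 _) (pow_nonneg h0 _)
            intro mu hmu
            obtain ⟨nu, hnu, rfl⟩ := Finset.mem_image.1 hmu
            rw [mem_filter, mem_box] at hnu
            rw [mem_box, rowLen_tail, rowLen_tail]
            have := nu.rowLen_anti L (L + 1) (Nat.le_succ L)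
            have := nu.rowLen_anti 0 (0 + 1) (Nat.le_succ 0)
            omega
    have h3 := Finset.sum_le_sum_of_subset_of_nonneg (f := fun nu : YoungDiagram => r ^ nu.card)
      hsub fun _ _ _ => pow_nonneg h0 _
    have h4 := Finset.sum_filter_add_sum_filter_not (box L (N + 1))
      (fun nu => nu.rowLen 0 = N + 1) fun nu => r ^ nu.card
    rw [Finset.prod_range_succ, ← div_eq_mul_inv, le_div_iff₀ hr]
    linarith

theorem prod_inv_le {r : ℝ} (h0 : 0 ≤ r) (h1 : r < 1) (N : ℕ) :
    ∏ k ∈ range N, (1 - r ^ (k + 1))⁻¹ ≤ Real.exp (1 / (1 - r) ^ 2) := by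
  have hr : 0 < 1 - r := sub_pos.2 h1
  have hk : ∀ k : ℕ, 0 < 1 - r ^ (k + 1) := fun k =>
    sub_pos.2 (pow_lt_one₀ h0 h1 (Nat.succ_ne_zero k))
  calc ∏ k ∈ range N, (1 - r ^ (k + 1))⁻¹
      ≤ ∏ k ∈ range N, Real.exp (r ^ k / (1 - r)) := by
        refine Finset.prod_le_prod (fun k _ => (inv_pos.2 (hk k)).le) fun k _ => ?_
        have h2 : r ^ (k + 1) ≤ r := by
          rw [pow_succ]; exact mul_le_of_le_one_left h0 (pow_le_one₀ h0 h1.le)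
        have h3 : r ^ (k + 1) ≤ r ^ k := pow_le_pow_of_le_one h0 h1.le (Nat.le_succ k)
        calc (1 - r ^ (k + 1))⁻¹ = r ^ (k + 1) / (1 - r ^ (k + 1)) + 1 := by
              field_simp [(hk k).ne']; ring
          _ ≤ r ^ k / (1 - r) + 1 := by
              gcongr
          _ ≤ _ := Real.add_one_le_exp _
    _ = Real.exp ((∑ k ∈ range N, r ^ k) / (1 - r)) := by
        rw [← Real.exp_sum, Finset.sum_div]
    _ ≤ _ := by
        refine Real.exp_le_exp.2 ?_
        have h2 : ∑ k ∈ range N, r ^ k ≤ (1 - r)⁻¹ := by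
          rw [← tsum_geometric_of_lt_one h0 h1]
          exact (summable_geometric_of_lt_one h0 h1).sum_le_tsum _ fun _ _ => pow_nonneg h0 _
        calc (∑ k ∈ range N, r ^ k) / (1 - r) ≤ (1 - r)⁻¹ / (1 - r) := by gcongr
          _ = _ := by field_simp

theorem summable_pow_card {r : ℝ} (h0 : 0 ≤ r) (h1 : r < 1) :
    Summable fun nu : YoungDiagram => r ^ nu.card := by
  refine summable_of_sum_le (c := Real.exp (1 / (1 - r) ^ 2)) (fun _ => pow_nonneg h0 _)
    fun u => ?_
  obtain ⟨N, hN⟩ := exists_subset_box u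
  exact (Finset.sum_le_sum_of_subset_of_nonneg (hN N le_rfl) fun _ _ _ => pow_nonneg h0 _).trans
    ((sum_box_le h0 h1 N N).trans (prod_inv_le h0 h1 N))

theorem summable_cpow_card {Q : ℂ} (hQ : ‖Q‖ < 1) :
    Summable fun nu : YoungDiagram => Q ^ nu.card :=
  Summable.of_norm (by simpa using summable_pow_card (norm_nonneg Q) hQ)

/-- The generating function of the partitions with parts at most `N`. -/
theorem tsum_rowLen_le_mul {Q : ℂ} (hQ : ‖Q‖ < 1) (N : ℕ) :
    (∑' nu : {nu : YoungDiagram | nu.rowLen 0 ≤ N}, Q ^ nu.1.card) *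
      ∏ k ∈ range N, (1 - Q ^ (k + 1)) = 1 := by
  have hs := summable_cpow_card hQ
  induction N with
  | zero =>
    have : {nu : YoungDiagram | nu.rowLen 0 ≤ 0} = {⊥} := by
      ext nu
      simp only [Set.mem_ofPred_eq, Set.mem_singleton_iff, Nat.le_zero]
      refine ⟨fun h => rowLen_injective (funext fun i => ?_), fun h => h ▸ rowLen_bot 0⟩
      have := nu.rowLen_anti 0 i (Nat.zero_le i)
      rw [rowLen_bot]
      omega
    rw [this, tsum_singleton ⊥ fun nu : YoungDiagram => Q ^ nu.card]
    simp [YoungDiagram.card]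
  | succ N ih =>
    have hU : {nu : YoungDiagram | nu.rowLen 0 ≤ N + 1} =
        {nu : YoungDiagram | nu.rowLen 0 ≤ N} ∪ {nu : YoungDiagram | nu.rowLen 0 = N + 1} := by
      ext nu
      simp only [Set.mem_ofPred_eq, Set.mem_union]
      omega
    have hD : Disjoint {nu : YoungDiagram | nu.rowLen 0 ≤ N}
        {nu : YoungDiagram | nu.rowLen 0 = N + 1} := by
      rw [Set.disjoint_left]
      intro nu h h'
      simp only [Set.mem_ofPred_eq] at h h'
      omega
    -- Deleting a first row of length N + 1 is a bijection onto the diagrams with parts at most N +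
    -- 1.
    let e : {nu : YoungDiagram | nu.rowLen 0 = N + 1} ≃
        {nu : YoungDiagram | nu.rowLen 0 ≤ N + 1} := Equiv.ofBijective
      (fun nu => ⟨tail nu.1, by
        have h1 := nu.1.rowLen_anti 0 (0 + 1) (Nat.le_succ 0)
        have h2 : nu.1.rowLen 0 = N + 1 := nu.2
        rw [Set.mem_ofPred_eq, rowLen_tail]
        omega⟩)
      ⟨fun a b h => Subtype.ext (tail_injOn (N + 1) a.2 b.2 (congrArg Subtype.val h)), fun mu => by
        obtain ⟨nu, h, h'⟩ := exists_tail_eq (m := N + 1) mu.2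
        exact ⟨⟨nu, h⟩, Subtype.ext h'⟩⟩
    have h2 : ∑' nu : {nu : YoungDiagram | nu.rowLen 0 = N + 1}, Q ^ nu.1.card =
        Q ^ (N + 1) * ∑' nu : {nu : YoungDiagram | nu.rowLen 0 ≤ N + 1}, Q ^ nu.1.card := by
      rw [← tsum_mul_left, ← e.tsum_eq]
      refine tsum_congr fun nu => ?_
      have h3 : nu.1.rowLen 0 = N + 1 := nu.2
      rw [card_eq_tail nu.1, h3, pow_add]
      rfl
    have h4 : ∑' nu : {nu : YoungDiagram | nu.rowLen 0 ≤ N + 1}, Q ^ nu.1.card =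
        ∑' nu : {nu : YoungDiagram | nu.rowLen 0 ≤ N}, Q ^ nu.1.card +
        ∑' nu : {nu : YoungDiagram | nu.rowLen 0 = N + 1}, Q ^ nu.1.card := by
      have := Summable.tsum_union_disjoint (f := fun nu : YoungDiagram => Q ^ nu.card) hD
        (hs.subtype _) (hs.subtype _)
      rw [← hU] at this
      exact this
    rw [h2] at h4
    rw [Finset.prod_range_succ]
    linear_combination ih + (∏ k ∈ range N, (1 - Q ^ (k + 1))) * h4

/-- The partial generating functions times the bounded products ∏ (1 - Q^k) are identically 1; a
zero limit would make these products tend to 0. -/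
theorem tsum_pow_card_ne_zero {Q : ℂ} (hQ : ‖Q‖ < 1) :
    ∑' nu : YoungDiagram, Q ^ nu.card ≠ 0 := by
  have h1 : Tendsto (fun N => ∑' nu : {nu : YoungDiagram | nu.rowLen 0 ≤ N}, Q ^ nu.1.card) atTop
      (𝓝 (∑' nu : YoungDiagram, Q ^ nu.card)) := by
    have h2 : ∀ N, ∑' nu : {nu : YoungDiagram | nu.rowLen 0 ≤ N}, Q ^ nu.1.card =
        ∑' nu : YoungDiagram, {nu : YoungDiagram | nu.rowLen 0 ≤ N}.indicator
          (fun nu => Q ^ nu.card) nu := fun N =>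
      _root_.tsum_subtype {nu : YoungDiagram | nu.rowLen 0 ≤ N} fun nu => Q ^ nu.card
    simp_rw [h2]
    refine tendsto_tsum_of_dominated_convergence (summable_pow_card (norm_nonneg Q) hQ)
      (fun nu => ?_) (Eventually.of_forall fun N nu => ?_)
    · refine tendsto_const_nhds.congr' ?_
      filter_upwards [eventually_ge_atTop (nu.rowLen 0)] with N hN
      rw [Set.indicator_of_mem (show nu ∈ {nu : YoungDiagram | nu.rowLen 0 ≤ N} from hN)]
    · refine (norm_indicator_le_norm_self _ _).trans ?_
      rw [norm_pow]
  intro h0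
  rw [h0] at h1
  have hb : ∀ N, ‖∏ k ∈ range N, (1 - Q ^ (k + 1))‖ ≤ Real.exp (1 - ‖Q‖)⁻¹ := by
    intro N
    rw [norm_prod]
    calc ∏ k ∈ range N, ‖1 - Q ^ (k + 1)‖ ≤ ∏ k ∈ range N, Real.exp (‖Q‖ ^ k) := by
          refine Finset.prod_le_prod (fun _ _ => norm_nonneg _) fun k _ => ?_
          refine (norm_sub_le _ _).trans ?_
          rw [norm_one, norm_pow, add_comm]
          refine le_trans ?_ (Real.add_one_le_exp _)
          have : ‖Q‖ ^ (k + 1) ≤ ‖Q‖ ^ k := pow_le_pow_of_le_one (norm_nonneg Q) hQ.le (Nat.le_succ k)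
          linarith
      _ = Real.exp (∑ k ∈ range N, ‖Q‖ ^ k) := (Real.exp_sum _ _).symm
      _ ≤ _ := by
          rw [← tsum_geometric_of_lt_one (norm_nonneg Q) hQ]
          exact Real.exp_le_exp.2 ((summable_geometric_of_lt_one (norm_nonneg Q) hQ).sum_le_tsum _
            fun _ _ => pow_nonneg (norm_nonneg Q) _)
  have h2 : Tendsto (fun N => (∑' nu : {nu : YoungDiagram | nu.rowLen 0 ≤ N}, Q ^ nu.1.card) *
      ∏ k ∈ range N, (1 - Q ^ (k + 1))) atTop (𝓝 0) := by
    refine NormedField.tendsto_zero_smul_of_tendsto_zero_of_bounded h1 ?_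
    exact ⟨_, Filter.eventually_map.2 (Eventually.of_forall hb)⟩
  simp_rw [tsum_rowLen_le_mul hQ] at h2
  exact one_ne_zero (tendsto_nhds_unique tendsto_const_nhds h2)

theorem norm_shiftPow_le {w : ℂ} (hw : 1 < ‖w‖) (nu : YoungDiagram) (i : ℕ) :
    ‖shiftPow w nu i‖ ≤ (‖w‖ ^ 2) ^ nu.card * ((‖w‖ ^ 2)⁻¹) ^ i := by
  have h0 : 0 < ‖w‖ := zero_lt_one.trans hw
  have h1 : (‖w‖ ^ 2) ^ nu.card * ((‖w‖ ^ 2)⁻¹) ^ i = ‖w‖ ^ (2 * (nu.card : ℤ) - 2 * i) := by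
    rw [zpow_sub₀ h0.ne', inv_pow, ← pow_mul, ← pow_mul, div_eq_mul_inv]
    norm_cast
  rw [shiftPow, norm_zpow, h1]
  refine zpow_le_zpow_right₀ hw.le ?_
  have := rowLen_le_card nu i
  omega

theorem summable_norm_shiftPow {w : ℂ} (hw : 1 < ‖w‖) (nu : YoungDiagram) :
    Summable fun i => ‖shiftPow w nu i‖ := by
  refine Summable.of_nonneg_of_le (fun _ => norm_nonneg _) (norm_shiftPow_le hw nu) ?_
  exact (summable_geometric_of_lt_one (by positivity)
    (inv_lt_one_of_one_lt₀ (one_lt_pow₀ hw two_ne_zero))).mul_left _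

theorem norm_shiftPow_injective {w : ℂ} (hw : 1 < ‖w‖) (nu : YoungDiagram) :
    Function.Injective fun i => ‖shiftPow w nu i‖ := by
  intro i j h
  simp only [shiftPow, norm_zpow] at h
  have h1 := zpow_right_injective₀ (zero_lt_one.trans hw) hw.ne' h
  rcases le_total i j with hij | hij
  · have := nu.rowLen_anti i j hij
    omega
  · have := nu.rowLen_anti j i hij
    omega

/-- Every row length is at most |ν|, so each factor is bounded by |s_j|^{|ν|} times a geometric
series. This is what the hypothesis |Q| |s_1 ⋯ s_n| < 1 has to absorb. -/
theorem norm_pointFactor_le {n : ℕ} {v : Fin n → ℂ} (hv : ∀ j, 1 < ‖v j‖) :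
    ∃ K : ℝ, 0 ≤ K ∧ ∀ nu, ‖pointFactor v nu‖ ≤ K * (∏ j, ‖v j‖ ^ 2) ^ nu.card := by
  refine ⟨∏ j, ∑' i : ℕ, ((‖v j‖ ^ 2)⁻¹) ^ i,
    Finset.prod_nonneg fun j _ => tsum_nonneg fun i => by positivity, fun nu => ?_⟩
  rw [pointFactor, norm_prod, ← Finset.prod_pow, ← Finset.prod_mul_distrib]
  refine Finset.prod_le_prod (fun _ _ => norm_nonneg _) fun j _ => ?_
  have hs : Summable fun i : ℕ => ((‖v j‖ ^ 2)⁻¹) ^ i := summable_geometric_of_lt_one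
    (by positivity) (inv_lt_one_of_one_lt₀ (one_lt_pow₀ (hv j) two_ne_zero))
  rw [mul_comm, ← tsum_mul_left]
  exact (norm_tsum_le_tsum_norm (summable_norm_shiftPow (hv j) nu)).trans
    ((summable_norm_shiftPow (hv j) nu).tsum_le_tsum (norm_shiftPow_le (hv j) nu)
      (hs.mul_left _))

/-! ### Convergence estimates and the main identity -/

theorem sum_pow_succ_le {T : ℝ} (h0 : 0 ≤ T) (h1 : T < 1) (n : ℕ) :
    ∑ k ∈ range n, T ^ (k + 1) ≤ T / (1 - T) := by
  have h2 : ∑ k ∈ range n, T ^ k ≤ (1 - T)⁻¹ := by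
    rw [← tsum_geometric_of_lt_one h0 h1]
    exact (summable_geometric_of_lt_one h0 h1).sum_le_tsum _ fun _ _ => pow_nonneg h0 _
  calc ∑ k ∈ range n, T ^ (k + 1) = T * ∑ k ∈ range n, T ^ k := by
        rw [Finset.mul_sum]; exact Finset.sum_congr rfl fun k _ => pow_succ' T k
    _ ≤ T * (1 - T)⁻¹ := mul_le_mul_of_nonneg_left h2 h0
    _ = _ := (div_eq_mul_inv _ _).symm

/-- Going away from the end of row i in either direction, |h| is at least 1, 2, 3, …, which gives
two geometric series. -/
theorem sum_pow_hook_row_le {T : ℝ} (h0 : 0 ≤ T) (h1 : T < 1) (nu : YoungDiagram) (i N : ℕ) :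
    ∑ j ∈ range N, T ^ (hook nu i j).natAbs ≤ 2 * (T / (1 - T)) := by
  set m := nu.rowLen i
  have hmem : ∀ j, i < nu.colLen j ↔ j < m := fun j => by
    rw [← YoungDiagram.mem_iff_lt_colLen, YoungDiagram.mem_iff_lt_rowLen]
  calc ∑ j ∈ range N, T ^ (hook nu i j).natAbs
      ≤ ∑ j ∈ range (m + N), T ^ (hook nu i j).natAbs :=
        Finset.sum_le_sum_of_subset_of_nonneg (Finset.range_mono (Nat.le_add_left N m))
          fun _ _ _ => pow_nonneg h0 _
    _ = ∑ j ∈ range m, T ^ (hook nu i j).natAbs +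
          ∑ k ∈ range N, T ^ (hook nu i (m + k)).natAbs := Finset.sum_range_add _ _ _
    _ ≤ ∑ j ∈ range m, T ^ (m - 1 - j + 1) + ∑ k ∈ range N, T ^ (k + 1) := by
        refine add_le_add (Finset.sum_le_sum fun j hj => ?_) (Finset.sum_le_sum fun k _ => ?_)
        · refine pow_le_pow_of_le_one h0 h1.le ?_
          have h2 := Finset.mem_range.1 hj
          have h3 := (hmem j).2 h2
          simp only [hook]
          omega
        · refine pow_le_pow_of_le_one h0 h1.le ?_
          have h3 := (hmem (m + k)).not.2 (by omega)
          simp only [hook]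
          omega
    _ = ∑ k ∈ range m, T ^ (k + 1) + ∑ k ∈ range N, T ^ (k + 1) := by
        rw [Finset.sum_range_reflect (fun k => T ^ (k + 1)) m]
    _ ≤ T / (1 - T) + T / (1 - T) :=
        add_le_add (sum_pow_succ_le h0 h1 m) (sum_pow_succ_le h0 h1 N)
    _ = _ := (two_mul _).symm

/-- Each of the l(ν) ≤ |ν| nonempty rows costs at most 2T/(1 - T) ≤ (8/3)T. Below them |h| ≥ k + j +
1 in the k-th empty row, and the double geometric series is at most (16/9)T < 1. -/
theorem sum_pow_hook_le {T : ℝ} (h0 : 0 ≤ T) (h1 : T ≤ 1 / 4) (nu : YoungDiagram) (N : ℕ) :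
    ∑ i ∈ range N, ∑ j ∈ range N, T ^ (hook nu i j).natAbs ≤ 3 * T * nu.card + 1 := by
  have hT : T < 1 := by linarith
  have hpos : 0 < 1 - T := by linarith
  have hg : T / (1 - T) ≤ 4 / 3 * T := by
    rw [div_le_iff₀ hpos]; nlinarith
  have hg0 : 0 ≤ T / (1 - T) := div_nonneg h0 hpos.le
  set l := nu.colLen 0
  calc ∑ i ∈ range N, ∑ j ∈ range N, T ^ (hook nu i j).natAbs
      ≤ ∑ i ∈ range (l + N), ∑ j ∈ range N, T ^ (hook nu i j).natAbs :=
        Finset.sum_le_sum_of_subset_of_nonneg (Finset.range_mono (Nat.le_add_left N l))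
          fun _ _ _ => Finset.sum_nonneg fun _ _ => pow_nonneg h0 _
    _ = ∑ i ∈ range l, ∑ j ∈ range N, T ^ (hook nu i j).natAbs +
          ∑ k ∈ range N, ∑ j ∈ range N, T ^ (hook nu (l + k) j).natAbs :=
        Finset.sum_range_add _ _ _
    _ ≤ ∑ i ∈ range l, 2 * (T / (1 - T)) + ∑ k ∈ range N, T ^ k * (T / (1 - T)) := by
        refine add_le_add (Finset.sum_le_sum fun i _ => sum_pow_hook_row_le h0 hT nu i N)
          (Finset.sum_le_sum fun k _ => ?_)
        refine le_trans ?_ (mul_le_mul_of_nonneg_left (sum_pow_succ_le h0 hT N) (pow_nonneg h0 k))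
        rw [Finset.mul_sum]
        refine Finset.sum_le_sum fun j _ => ?_
        rw [← pow_add]
        refine pow_le_pow_of_le_one h0 hT.le ?_
        have h2 := nu.colLen_anti 0 j (Nat.zero_le j)
        have h3 : nu.rowLen (l + k) = 0 := rowLen_eq_zero_iff.2 (Nat.le_add_right l k)
        simp only [hook]
        omega
    _ ≤ l * (2 * (4 / 3 * T)) + 4 / 3 * (4 / 3 * T) := by
        rw [Finset.sum_const, Finset.card_range, nsmul_eq_mul, ← Finset.sum_mul]
        have h2 : ∑ k ∈ range N, T ^ k ≤ 4 / 3 := by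
          refine ((summable_geometric_of_lt_one h0 hT).sum_le_tsum _
            fun _ _ => pow_nonneg h0 _).trans ?_
          rw [tsum_geometric_of_lt_one h0 hT]
          exact inv_le_of_inv_le₀ (by norm_num) (by linarith)
        gcongr
    _ ≤ _ := by
        have h2 : (l : ℝ) ≤ nu.card := by exact_mod_cast colLen_le_card nu 0
        have h3 := mul_le_mul_of_nonneg_right h2 h0
        nlinarith

/-- Already (1 + 3u)(1 - u) ≥ 1 + u for 0 ≤ u ≤ 1/3. -/
theorem one_add_le_exp_mul {u : ℝ} (h0 : 0 ≤ u) (h1 : u ≤ 1 / 4) :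
    1 + u ≤ Real.exp (3 * u) * (1 - u) := by
  have h2 : (3 * u + 1) * (1 - u) ≤ Real.exp (3 * u) * (1 - u) :=
    mul_le_mul_of_nonneg_right (Real.add_one_le_exp _) (by linarith)
  nlinarith

theorem one_add_norm_zpow_le {w : ℂ} (hw : 1 < ‖w‖) (hT : (‖w‖ ^ 2)⁻¹ ≤ 1 / 4) {d : ℤ}
    (hd : d ≠ 0) :
    1 + ‖w ^ (2 * d)‖ ≤ Real.exp (3 * ((‖w‖ ^ 2)⁻¹) ^ d.natAbs) * ‖1 - w ^ (2 * d)‖ := by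
  have hw0 : 0 < ‖w‖ := zero_lt_one.trans hw
  set u := ((‖w‖ ^ 2)⁻¹) ^ d.natAbs with hu
  have hu0 : 0 < u := by positivity
  have hu1 : u ≤ 1 / 4 := by
    refine le_trans ?_ hT
    exact pow_le_of_le_one (by positivity) (by linarith) (by omega)
  have hu' : u = ‖w‖ ^ (-(2 * |d|)) := by
    rw [hu, zpow_neg, zpow_mul, inv_pow, Int.abs_eq_natAbs, zpow_natCast]
    norm_cast
  have key := one_add_le_exp_mul hu0.le hu1
  rcases lt_or_gt_of_ne hd with h | h
  · have h2 : ‖w ^ (2 * d)‖ = u := by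
      rw [hu', norm_zpow, abs_of_neg h]
      congr 1
      ring
    rw [h2]
    refine key.trans (mul_le_mul_of_nonneg_left ?_ (Real.exp_pos _).le)
    have := norm_sub_norm_le (1 : ℂ) (w ^ (2 * d))
    rwa [norm_one, h2] at this
  -- For d > 0 the factor u⁻¹ is taken out of both sides, which reduces the claim to the same
  -- inequality in u.
  · have h2 : ‖w ^ (2 * d)‖ = u⁻¹ := by
      rw [hu', norm_zpow, abs_of_pos h, zpow_neg, inv_inv]
    have h3 : u⁻¹ - 1 ≤ ‖1 - w ^ (2 * d)‖ := by
      have := norm_sub_norm_le (w ^ (2 * d)) 1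
      rwa [norm_one, h2, norm_sub_rev] at this
    rw [h2]
    refine le_trans ?_ (mul_le_mul_of_nonneg_left h3 (Real.exp_pos _).le)
    have h4 := mul_le_mul_of_nonneg_left key (inv_pos.2 hu0).le
    have h5 : u⁻¹ * u = 1 := inv_mul_cancel₀ hu0.ne'
    calc 1 + u⁻¹ = u⁻¹ * (1 + u) := by rw [mul_add, h5]; ring
      _ ≤ _ := h4
      _ = Real.exp (3 * u) * (u⁻¹ - u⁻¹ * u) := by ring
      _ = _ := by rw [h5]

/-- No factor 1 - q^h is close to 0, as h ≠ 0 and |q| ≥ 4. Replacing it by 1 + |q|^h costs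
exp(3|q|^{-|h|}), and the sum of the |q|^{-|h|} is at most 3|ν|/|q| + 1. -/
theorem prod_one_add_norm_le {w : ℂ} (hw : 1 < ‖w‖) (hT : (‖w‖ ^ 2)⁻¹ ≤ 1 / 4)
    (nu : YoungDiagram) (N : ℕ) :
    ∏ i ∈ range N, ∏ j ∈ range N, (1 + ‖shiftPow w nu i‖ * ‖shiftPow w nu.transpose j‖) ≤
      Real.exp (9 * (‖w‖ ^ 2)⁻¹ * nu.card + 3) *
        ‖∏ i ∈ range N, ∏ j ∈ range N, (1 - shiftPow w nu i * shiftPow w nu.transpose j)‖ := by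
  have hw0 : w ≠ 0 := norm_pos_iff.1 (zero_lt_one.trans hw)
  calc ∏ i ∈ range N, ∏ j ∈ range N, (1 + ‖shiftPow w nu i‖ * ‖shiftPow w nu.transpose j‖)
      ≤ ∏ i ∈ range N, ∏ j ∈ range N, (Real.exp (3 * ((‖w‖ ^ 2)⁻¹) ^ (hook nu i j).natAbs) *
          ‖1 - shiftPow w nu i * shiftPow w nu.transpose j‖) := by
        refine Finset.prod_le_prod (fun i _ => Finset.prod_nonneg fun j _ => by positivity)
          fun i _ => Finset.prod_le_prod (fun j _ => by positivity) fun j _ => ?_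
        rw [← norm_mul, shiftPow_mul_shiftPow hw0]
        exact one_add_norm_zpow_le hw hT (hook_ne_zero nu i j)
    _ = Real.exp (3 * ∑ i ∈ range N, ∑ j ∈ range N, ((‖w‖ ^ 2)⁻¹) ^ (hook nu i j).natAbs) *
          ‖∏ i ∈ range N, ∏ j ∈ range N, (1 - shiftPow w nu i * shiftPow w nu.transpose j)‖ := by
        simp_rw [Finset.prod_mul_distrib, norm_prod, ← Real.exp_sum, ← Finset.mul_sum]
    _ ≤ _ := by
        refine mul_le_mul_of_nonneg_right (Real.exp_le_exp.2 ?_) (norm_nonneg _)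
        have := sum_pow_hook_le (T := (‖w‖ ^ 2)⁻¹) (by positivity) hT nu N
        linarith

theorem norm_prod_bot_le {w : ℂ} (hw : 1 < ‖w‖) (hT : (‖w‖ ^ 2)⁻¹ ≤ 1 / 4) (N : ℕ) :
    ‖∏ i ∈ range N, ∏ j ∈ range N, (1 - shiftPow w ⊥ i * shiftPow w ⊥ j)‖ ≤ Real.exp 1 := by
  have hw0 : w ≠ 0 := norm_pos_iff.1 (zero_lt_one.trans hw)
  simp_rw [norm_prod]
  calc ∏ i ∈ range N, ∏ j ∈ range N, ‖1 - shiftPow w ⊥ i * shiftPow w ⊥ j‖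
      ≤ ∏ i ∈ range N, ∏ j ∈ range N, Real.exp (((‖w‖ ^ 2)⁻¹) ^ (hook ⊥ i j).natAbs) := by
        refine Finset.prod_le_prod (fun i _ => Finset.prod_nonneg fun j _ => norm_nonneg _)
          fun i _ => Finset.prod_le_prod (fun j _ => norm_nonneg _) fun j _ => ?_
        refine (norm_sub_le _ _).trans ?_
        have h1 := shiftPow_mul_shiftPow hw0 ⊥ i j
        rw [transpose_bot] at h1
        have h2 : ‖w ^ (2 * hook ⊥ i j)‖ = ((‖w‖ ^ 2)⁻¹) ^ (hook ⊥ i j).natAbs := by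
          rw [norm_zpow, hook_bot, inv_pow, ← pow_mul,
            show (-((i : ℤ) + j + 1)).natAbs = i + j + 1 by omega, ← zpow_natCast, ← zpow_neg]
          congr 1
        rw [h1, h2, norm_one, add_comm]
        exact Real.add_one_le_exp _
    _ = Real.exp (∑ i ∈ range N, ∑ j ∈ range N, ((‖w‖ ^ 2)⁻¹) ^ (hook ⊥ i j).natAbs) := by
        simp_rw [← Real.exp_sum]
    _ ≤ _ := by
        refine Real.exp_le_exp.2 ?_
        simpa [YoungDiagram.card] using
          sum_pow_hook_le (T := (‖w‖ ^ 2)⁻¹) (by positivity) hT ⊥ N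

/-! ### The sum over μ -/

/-- The part of the summand depending on `ν` only, without the power of `Q`. -/
def schurPair (w : ℂ) (nu : YoungDiagram) : ℂ :=
  evalAt (shiftPow w ⊥) (schur nu) * evalAt (shiftPow w ⊥) (schur nu.transpose)

/-- The sum over `μ` of the part of the summand depending on `μ`. -/
def innerSum (w : ℂ) (nu : YoungDiagram) : ℂ :=
  ∑' mu : YoungDiagram, (-1) ^ mu.card *
    (evalAt (shiftPow w nu) (schur mu) * evalAt (shiftPow w nu.transpose) (schur mu.transpose))

theorem tendsto_innerSum {w : ℂ} (hw : 1 < ‖w‖) (nu : YoungDiagram) :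
    Tendsto (fun N => ∏ i ∈ range N, ∏ j ∈ range N,
      (1 - shiftPow w nu i * shiftPow w nu.transpose j)) atTop (𝓝 (innerSum w nu)) := by
  have hs := summable_norm_shiftPow hw nu.transpose
  have h := dual_cauchy (x := shiftPow w nu) (y := fun j => -1 * shiftPow w nu.transpose j)
    (summable_norm_shiftPow hw nu) (by simpa using hs) (norm_shiftPow_injective hw nu)
  have h2 : ∀ mu : YoungDiagram, evalAt (shiftPow w nu) (schur mu) *
      evalAt (fun j => -1 * shiftPow w nu.transpose j) (schur mu.transpose) =
      (-1) ^ mu.card * (evalAt (shiftPow w nu) (schur mu) *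
        evalAt (shiftPow w nu.transpose) (schur mu.transpose)) := by
    intro mu
    rw [evalAt_smul hs, card_transpose]
    ring
  simp_rw [h2] at h
  refine h.congr fun N => Finset.prod_congr rfl fun i _ => Finset.prod_congr rfl fun j _ => ?_
  ring

theorem tendsto_schurPair {w : ℂ} (hw : 1 < ‖w‖) (nu : YoungDiagram) :
    Tendsto (fun N => schurFin (shiftPow w ⊥) N nu * schurFin (shiftPow w ⊥) N nu.transpose)
      atTop (𝓝 (schurPair w nu)) :=
  (tendsto_schurFin (summable_norm_shiftPow hw ⊥) nu).mul
    (tendsto_schurFin (summable_norm_shiftPow hw ⊥) nu.transpose)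

theorem schurPair_mul_innerSum {w : ℂ} (hw : 1 < ‖w‖) (nu : YoungDiagram) :
    schurPair w nu * innerSum w nu = (-1) ^ nu.card * innerSum w ⊥ := by
  have h1 := (tendsto_schurPair hw nu).mul (tendsto_innerSum hw nu)
  have h2 := (tendsto_innerSum hw ⊥).const_mul ((-1) ^ nu.card)
  rw [transpose_bot] at h2
  refine tendsto_nhds_unique (h1.congr' ?_) h2
  obtain ⟨N₀, hN₀⟩ := exists_subset_box {nu}
  filter_upwards [eventually_ge_atTop N₀] with N hN
  exact schurFin_mul_schurFin_mul_prod hw (hN₀ N hN (mem_singleton_self nu))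

/-- A limit of nonzero products could still be 0. The comparison with ∏ (1 + |x_i y_j|) ≥ 1 keeps
the norm at least e^{-3}. -/
theorem innerSum_bot_ne_zero {w : ℂ} (hw : 1 < ‖w‖) (hT : (‖w‖ ^ 2)⁻¹ ≤ 1 / 4) :
    innerSum w ⊥ ≠ 0 := by
  have h1 : 1 ≤ Real.exp (9 * (‖w‖ ^ 2)⁻¹ * (⊥ : YoungDiagram).card + 3) * ‖innerSum w ⊥‖ := by
    refine ge_of_tendsto' ((tendsto_innerSum hw ⊥).norm.const_mul _) fun N => ?_
    refine le_trans ?_ (prod_one_add_norm_le hw hT ⊥ N)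
    have hge : ∀ a b : ℂ, 1 ≤ 1 + ‖a‖ * ‖b‖ := fun a b =>
      le_add_of_nonneg_right (mul_nonneg (norm_nonneg _) (norm_nonneg _))
    exact Finset.one_le_prod fun i _ => Finset.one_le_prod fun j _ => hge _ _
  intro h
  rw [h, norm_zero, mul_zero] at h1
  linarith

/-- The sum of absolute values over μ is traded for the actual product at the price exp(9|ν|/|q| +
3). The product formula then removes the dependence on ν, and the product for ∅ is at most e. -/
theorem norm_schurPair_mul_sum_le {w : ℂ} (hw : 1 < ‖w‖) (hT : (‖w‖ ^ 2)⁻¹ ≤ 1 / 4)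
    (nu : YoungDiagram) (u : Finset YoungDiagram) :
    ‖schurPair w nu‖ * ∑ mu ∈ u, absSchur (shiftPow w nu) mu *
      absSchur (shiftPow w nu.transpose) mu.transpose ≤
      Real.exp 4 * Real.exp (9 * (‖w‖ ^ 2)⁻¹) ^ nu.card := by
  have hx := summable_norm_shiftPow hw nu
  have hy := summable_norm_shiftPow hw nu.transpose
  classical
  obtain ⟨N₀, hN₀⟩ := exists_subset_box (insert nu u)
  refine le_of_tendsto ((tendsto_schurPair hw nu).norm.mul (tendsto_finsetSum u fun mu _ =>
    (tendsto_absSchur hx mu).mul (tendsto_absSchur hy mu.transpose))) ?_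
  filter_upwards [eventually_ge_atTop N₀] with N hN
  have hbox := hN₀ N hN
  have h1 : ∑ mu ∈ u, schurFin (fun i => ‖shiftPow w nu i‖) N mu *
      schurFin (fun i => ‖shiftPow w nu.transpose i‖) N mu.transpose ≤
      ∏ i ∈ range N, ∏ j ∈ range N,
        (1 + ‖shiftPow w nu i‖ * ‖shiftPow w nu.transpose j‖) := by
    rw [← dual_cauchy_fin (norm_shiftPow_injective hw nu)]
    exact Finset.sum_le_sum_of_subset_of_nonneg ((Finset.subset_insert _ _).trans hbox)
      fun mu _ _ => mul_nonneg (schurFin_nonneg (fun _ => norm_nonneg _) N _)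
        (schurFin_nonneg (fun _ => norm_nonneg _) N _)
  have h2 := schurFin_mul_schurFin_mul_prod hw (hbox (mem_insert_self nu u))
  have h3 := congrArg norm h2
  rw [norm_mul, norm_mul ((-1) ^ nu.card), norm_pow, norm_neg, norm_one, one_pow, one_mul] at h3
  have h4 := norm_prod_bot_le hw hT N
  rw [← h3] at h4
  calc _ ≤ ‖schurFin (shiftPow w ⊥) N nu * schurFin (shiftPow w ⊥) N nu.transpose‖ *
        (Real.exp (9 * (‖w‖ ^ 2)⁻¹ * nu.card + 3) *
          ‖∏ i ∈ range N, ∏ j ∈ range N,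
            (1 - shiftPow w nu i * shiftPow w nu.transpose j)‖) :=
        mul_le_mul_of_nonneg_left (h1.trans (prod_one_add_norm_le hw hT nu N)) (norm_nonneg _)
    _ = Real.exp (9 * (‖w‖ ^ 2)⁻¹ * nu.card + 3) *
        (‖schurFin (shiftPow w ⊥) N nu * schurFin (shiftPow w ⊥) N nu.transpose‖ *
          ‖∏ i ∈ range N, ∏ j ∈ range N,
            (1 - shiftPow w nu i * shiftPow w nu.transpose j)‖) := by ring
    _ ≤ Real.exp (9 * (‖w‖ ^ 2)⁻¹ * nu.card + 3) * Real.exp 1 :=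
        mul_le_mul_of_nonneg_left h4 (Real.exp_pos _).le
    _ = _ := by
        rw [← Real.exp_nat_mul, ← Real.exp_add, ← Real.exp_add]
        congr 1
        ring

theorem tsum_zTerm {w : ℂ} (hw : 1 < ‖w‖) (Q : ℂ) (nu : YoungDiagram) :
    ∑' mu, zTerm Q 1 w (mu, nu) = innerSum w ⊥ * Q ^ nu.card := by
  have hw0 : w ≠ 0 := norm_pos_iff.1 (zero_lt_one.trans hw)
  simp_rw [zTerm_one_eq hw0]
  rw [tsum_mul_left, ← innerSum, ← schurPair, mul_assoc, schurPair_mul_innerSum hw, neg_pow]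
  have h : ((-1 : ℂ)) ^ nu.card * (-1) ^ nu.card = 1 := by
    rw [← mul_pow]; simp
  linear_combination (Q ^ nu.card * innerSum w ⊥) * h

theorem summable_zTerm_mul {w : ℂ} (hw : 1 < ‖w‖) (hT : (‖w‖ ^ 2)⁻¹ ≤ 1 / 4) {Q : ℂ}
    {f : YoungDiagram → ℂ} {K S : ℝ} (hK : 0 ≤ K) (hS : 0 ≤ S)
    (hf : ∀ nu, ‖f nu‖ ≤ K * S ^ nu.card)
    (hlt : ‖Q‖ * S * Real.exp (9 * (‖w‖ ^ 2)⁻¹) < 1) :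
    Summable fun p : YoungDiagram × YoungDiagram => zTerm Q 1 w p * f p.2 := by
  have hw0 : w ≠ 0 := norm_pos_iff.1 (zero_lt_one.trans hw)
  have hg := summable_pow_card (r := ‖Q‖ * S * Real.exp (9 * (‖w‖ ^ 2)⁻¹)) (by positivity) hlt
  set r := ‖Q‖ * S * Real.exp (9 * (‖w‖ ^ 2)⁻¹) with hr
  have hin : ∀ (nu : YoungDiagram) (u : Finset YoungDiagram),
      ∑ mu ∈ u, ‖zTerm Q 1 w (mu, nu) * f nu‖ ≤ Real.exp 4 * K * r ^ nu.card := by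
    intro nu u
    have h1 : ∀ mu, ‖zTerm Q 1 w (mu, nu) * f nu‖ ≤ ‖Q‖ ^ nu.card * (‖schurPair w nu‖ *
        (absSchur (shiftPow w nu) mu * absSchur (shiftPow w nu.transpose) mu.transpose)) *
          (K * S ^ nu.card) := by
      intro mu
      rw [zTerm_one_eq hw0, ← schurPair]
      simp only [norm_mul, norm_pow, norm_neg, norm_one, one_pow, one_mul]
      rw [mul_assoc (‖Q‖ ^ nu.card)]
      have e1 := norm_evalAt_le_absSchur (summable_norm_shiftPow hw nu) mu
      have e2 := norm_evalAt_le_absSchur (summable_norm_shiftPow hw nu.transpose) mu.transpose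
      have e3 := hf nu
      have e4 : 0 ≤ absSchur (shiftPow w nu) mu := norm_nonneg _
      have e5 : 0 ≤ absSchur (shiftPow w nu.transpose) mu.transpose := norm_nonneg _
      gcongr
    refine (Finset.sum_le_sum fun mu _ => h1 mu).trans ?_
    rw [← Finset.sum_mul, ← Finset.mul_sum, ← Finset.mul_sum]
    have h2 := norm_schurPair_mul_sum_le hw hT nu u
    calc _ ≤ ‖Q‖ ^ nu.card * (Real.exp 4 * Real.exp (9 * (‖w‖ ^ 2)⁻¹) ^ nu.card) *
          (K * S ^ nu.card) := by gcongr
      _ = _ := by rw [hr, mul_pow, mul_pow]; ring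
  refine Summable.of_norm (summable_of_sum_le
    (c := ∑' nu : YoungDiagram, Real.exp 4 * K * r ^ nu.card) (fun _ => norm_nonneg _) fun u => ?_)
  classical
  calc ∑ p ∈ u, ‖zTerm Q 1 w p * f p.2‖
      -- The finite set is enlarged to a rectangle so that, for each ν, the sum over μ can be
      -- bounded first.
      ≤ ∑ p ∈ u.image Prod.fst ×ˢ u.image Prod.snd, ‖zTerm Q 1 w p * f p.2‖ :=
        Finset.sum_le_sum_of_subset_of_nonneg Finset.subset_product fun _ _ _ => norm_nonneg _
    _ = ∑ nu ∈ u.image Prod.snd, ∑ mu ∈ u.image Prod.fst, ‖zTerm Q 1 w (mu, nu) * f nu‖ :=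
        Finset.sum_product_right _ _ _
    _ ≤ ∑ nu ∈ u.image Prod.snd, Real.exp 4 * K * r ^ nu.card :=
        Finset.sum_le_sum fun nu _ => hin nu _
    _ ≤ _ := (hg.mul_left _).sum_le_tsum _ fun _ _ => by positivity

theorem tsum_zTerm_mul {w : ℂ} (hw : 1 < ‖w‖) {Q : ℂ} {f : YoungDiagram → ℂ}
    (hs : Summable fun p : YoungDiagram × YoungDiagram => zTerm Q 1 w p * f p.2) :
    ∑' p : YoungDiagram × YoungDiagram, zTerm Q 1 w p * f p.2 =
      innerSum w ⊥ * ∑' nu : YoungDiagram, f nu * Q ^ nu.card := by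
  have hs' : Summable fun p : YoungDiagram × YoungDiagram =>
      zTerm Q 1 w (Equiv.prodComm _ _ p) * f (Equiv.prodComm _ _ p).2 :=
    (Equiv.prodComm YoungDiagram YoungDiagram).summable_iff.2 hs
  rw [← (Equiv.prodComm YoungDiagram YoungDiagram).tsum_eq, hs'.tsum_prod, ← tsum_mul_left]
  refine tsum_congr fun nu => ?_
  simp only [Equiv.prodComm_apply, Prod.swap_prod_mk]
  rw [tsum_mul_right, tsum_zTerm hw]
  ring

end

end TopVertex

/-! ### The main theorem -/

theorem mainTheorem7 (n : ℕ) (Q : ℂ) (s v : Fin n → ℂ) (hv : ∀ j, v j ^ 2 = s j)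
    (hs : ∀ j, 1 < ‖s j‖) (hQ : ‖Q‖ < 1) (hQs : ‖Q‖ * ∏ j, ‖s j‖ < 1) :
    (∀ (nu : YoungDiagram) (j : Fin n), Summable (TopVertex.shiftPow (v j) nu)) ∧
    Summable (fun nu : YoungDiagram => Q ^ nu.card) ∧
    (∑' nu : YoungDiagram, Q ^ nu.card) ≠ 0 ∧
    Summable (fun nu : YoungDiagram => TopVertex.pointFactor v nu * Q ^ nu.card) ∧
    (∀ᶠ w : ℂ in Bornology.cobounded ℂ,
      Summable (TopVertex.zTerm Q 1 w) ∧
      TopVertex.Z Q 1 w ≠ 0 ∧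
      Summable (fun p : YoungDiagram × YoungDiagram =>
        TopVertex.zTerm Q 1 w p * TopVertex.pointFactor v p.2)) ∧
    Filter.Tendsto (fun w : ℂ => TopVertex.Zn Q 1 w v) (Bornology.cobounded ℂ)
      (nhds (TopVertex.blochOkounkov Q v)) := by
  have hv2 : ∀ j, ‖v j‖ ^ 2 = ‖s j‖ := fun j => by rw [← norm_pow, hv]
  have hv1 : ∀ j, 1 < ‖v j‖ := fun j =>
    (one_lt_pow_iff_of_nonneg (norm_nonneg _) two_ne_zero).1 ((hs j).trans_eq (hv2 j).symm)
  obtain ⟨K, hK, hbound⟩ := TopVertex.norm_pointFactor_le hv1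
  simp_rw [hv2] at hbound
  have hS0 : 0 ≤ ∏ j, ‖s j‖ := Finset.prod_nonneg fun j _ => norm_nonneg _
  have hP := TopVertex.tsum_pow_card_ne_zero hQ
  have hlim : Filter.Tendsto (fun w : ℂ => (‖w‖ ^ 2)⁻¹) (Bornology.cobounded ℂ) (nhds 0) :=
    tendsto_inv_atTop_zero.comp
      ((Filter.tendsto_pow_atTop two_ne_zero).comp tendsto_norm_cobounded_atTop)
  -- As |q| = |w|² → ∞ the loss e^{9/|q|} tends to 1, so the strict inequality survives. Letting w
  -- range over a neighbourhood of infinity covers both choices of q^{1/2}.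
  have hlt : ∀ S : ℝ, ‖Q‖ * S < 1 → ∀ᶠ w : ℂ in Bornology.cobounded ℂ,
      ‖Q‖ * S * Real.exp (9 * (‖w‖ ^ 2)⁻¹) < 1 := by
    intro S hS
    have h := ((Real.continuous_exp.tendsto _).comp (hlim.const_mul 9)).const_mul (‖Q‖ * S)
    rw [mul_zero, Real.exp_zero, mul_one] at h
    exact h.eventually_lt_const hS
  have hev : ∀ᶠ w : ℂ in Bornology.cobounded ℂ,
      Summable (TopVertex.zTerm Q 1 w) ∧ TopVertex.Z Q 1 w ≠ 0 ∧
      Summable (fun p : YoungDiagram × YoungDiagram =>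
        TopVertex.zTerm Q 1 w p * TopVertex.pointFactor v p.2) ∧
      TopVertex.Zn Q 1 w v = TopVertex.blochOkounkov Q v := by
    -- S = 1 serves the partition function, where the extra factor is 1, and S = |s_1 ⋯ s_n| the
    -- numerator; both sums carry the same constant `innerSum w ⊥`, which cancels.
    filter_upwards [hlt 1 (by simpa using hQ), hlt _ hQs,
      hlim.eventually_lt_const (show (0 : ℝ) < 1 / 4 by norm_num),
      tendsto_norm_cobounded_atTop.eventually_gt_atTop 1] with w h1 h2 h3 hw
    have e1 := TopVertex.summable_zTerm_mul hw h3.le (Q := Q) (f := fun _ => 1)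
      (K := 1) (S := 1) zero_le_one zero_le_one (fun nu => by simp) h1
    have e2 := TopVertex.summable_zTerm_mul hw h3.le (Q := Q)
      (f := TopVertex.pointFactor v) hK hS0 hbound h2
    have hc := TopVertex.innerSum_bot_ne_zero hw h3.le
    have t1 := TopVertex.tsum_zTerm_mul (f := fun _ => 1) hw e1
    have t2 := TopVertex.tsum_zTerm_mul (f := TopVertex.pointFactor v) hw e2
    simp only [mul_one, one_mul] at e1 t1
    refine ⟨e1, ?_, e2, ?_⟩
    · rw [TopVertex.Z, t1]
      exact mul_ne_zero hc hP
    · rw [TopVertex.Zn, TopVertex.Z, t1, t2, TopVertex.blochOkounkov]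
      field_simp
  refine ⟨fun nu j => (TopVertex.summable_norm_shiftPow (hv1 j) nu).of_norm,
    TopVertex.summable_cpow_card hQ, hP, ?_, hev.mono fun w h => ⟨h.1, h.2.1, h.2.2.1⟩,
    tendsto_const_nhds.congr' (hev.mono fun w h => h.2.2.2.symm)⟩
  refine Summable.of_norm_bounded ((TopVertex.summable_pow_card
    (mul_nonneg (norm_nonneg Q) hS0) hQs).mul_left K) fun nu => ?_
  rw [norm_mul, norm_pow, mul_pow]
  calc _ ≤ K * (∏ j, ‖s j‖) ^ nu.card * ‖Q‖ ^ nu.card :=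
        mul_le_mul_of_nonneg_right (hbound nu) (by positivity)
    _ = _ := by ring
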